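/- All Hilbert spaces are finite-dimensional, complex and nonzero; $|\mathrm H|$ is the dimension of $\mathrm H$, $\mathcal L(\mathrm H)$ the set of linear operators on $\mathrm H$, $\mathcal D(\mathrm H)$ the set of density operators (positive semidefinite, trace $1$), $\leq$ the Loewner order, $\|\cdot\|_1$ the trace norm and $\log$ the natural logarithm. The Kraus rank of a completely positive (CP) map $\mathcal M:\mathcal L(\mathrm A)\to\mathcal L(\mathrm B)$ is the least $r\ge 0$ such that $\mathcal M(X)=\sum_{i=1}^r K_iXK_i^\dagger$ for some operators $K_i:\mathrm A\to\mathrm B$. There is a universal constant $C>0$ such that the following holds. Let $0<\varepsilon<1$, let $\mathcal N:\mathcal L(\mathrm A)\to\mathcal L(\mathrm B)$ be a completely positive trace preserving (CPTP) map whose Kraus rank $|\mathrm E|$ satisfies $|\mathrm E|\geq|\mathrm A|$ and $|\mathrm E|\ge|\mathrm B|$, and put $$ R = C\,\frac{\max(|\mathrm A|,|\mathrm B|)\,\log(|\mathrm E|/\varepsilon)}{\varepsilon^2}. $$ (1) There is a CP map $\widehat{\mathcal N}:\mathcal L(\mathrm A)\to\mathcal L(\mathrm B)$ with Kraus rank at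 most $R$ such that $$ \forall\,\varrho\in\mathcal D(\mathrm A),\quad -\varepsilon\Big(\mathcal N(\varrho)+\frac{\mathbb 1}{|\mathrm B|}\Big)\leq\widehat{\mathcal N}(\varrho)-\mathcal N(\varrho)\leq\varepsilon\Big(\mathcal N(\varrho)+\frac{\mathbb 1}{|\mathrm B|}\Big), \qquad (*) $$ and in particular $\|\widehat{\mathcal N}(\varrho)-\mathcal N(\varrho)\|_1\leq 2\varepsilon$ for all $\varrho\in\mathcal D(\mathrm A)$. (2) Such maps are obtained by random sampling of environment vectors: let $\mathrm E=\mathbb C^{|\mathrm E|}$ and let $V:\mathrm A\to\mathrm B\otimes\mathrm E$ be any isometry with $\mathcal N(X)=\mathrm{tr}_{\mathrm E}(VXV^\dagger)$ for all $X$. For every integer $n\geq R$, if $\varphi_1,\dots,\varphi_n$ are independent uniformly distributed unit vectors of $\mathrm E$, then with probability at least $1/2$ the map $$ \widehat{\mathcal N}(X)=\frac1n\sum_{i=1}^n|\mathrm E|\,\mathrm{tr}_{\mathrm E}\big[(\mathbb 1\otimes|\varphi_i\rangle\langle\varphi_i|)\,VXV^\dagger\,(\mathbb 1\otimes|\varphi_i\rangle\langle\varphi_i|)\big]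 $$ is CP with Kraus rank at most $n$ and satisfies $(*)$. (3) If $2\varepsilon\leq|\mathrm E|$ (which holds automatically unless $|\mathrm A|=|\mathrm B|=|\mathrm E|=1$ and $\varepsilon>1/2$), there is a CPTP map $\widehat{\mathcal N}:\mathcal L(\mathrm A)\to\mathcal L(\mathrm B)$ with Kraus rank at most $R$ such that $\|\widehat{\mathcal N}(\varrho)-\mathcal N(\varrho)\|_1\leq 2\varepsilon$ for all $\varrho\in\mathcal D(\mathrm A)$. -/

import Mathlib

open scoped Matrix MatrixOrder Kronecker ComplexOrder

namespace ChannelCompression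

/-- Density operators: positive semidefinite matrices of trace one. -/
def IsState {A : Type*} [Fintype A] (ρ : Matrix A A ℂ) : Prop :=
  ρ.PosSemidef ∧ ρ.trace = 1

/-- The amplification `id ⊗ N` on `k × k` block matrices: `N` is applied to every block. -/
def amplify {A B : Type*} (k : ℕ) (N : Matrix A A ℂ →ₗ[ℂ] Matrix B B ℂ)
    (X : Matrix (Fin k × A) (Fin k × A) ℂ) : Matrix (Fin k × B) (Fin k × B) ℂ :=
  Matrix.of fun p q => N (Matrix.of fun a a' => X (p.1, a) (q.1, a')) p.2 q.2

/-- Complete positivity: all amplifications preserve positive semidefiniteness. -/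
def IsCP {A B : Type*} (N : Matrix A A ℂ →ₗ[ℂ] Matrix B B ℂ) : Prop :=
  ∀ (k : ℕ) (X : Matrix (Fin k × A) (Fin k × A) ℂ), X.PosSemidef → (amplify k N X).PosSemidef

/-- Trace preservation. -/
def IsTP {A B : Type*} [Fintype A] [Fintype B]
    (N : Matrix A A ℂ →ₗ[ℂ] Matrix B B ℂ) : Prop :=
  ∀ X : Matrix A A ℂ, (N X).trace = X.trace

/-- `N` can be written with `s` Kraus operators. -/
def HasKraus {A B : Type*} [Fintype A]
    (N : Matrix A A ℂ →ₗ[ℂ] Matrix B B ℂ) (s : ℕ) : Prop :=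
  ∃ K : Fin s → Matrix B A ℂ, ∀ X : Matrix A A ℂ, N X = ∑ i, K i * X * (K i)ᴴ

/-- The Kraus rank: the least number of Kraus operators
(every completely positive map has a Kraus decomposition). -/
noncomputable def krausRank {A B : Type*} [Fintype A]
    (N : Matrix A A ℂ →ₗ[ℂ] Matrix B B ℂ) : ℕ :=
  sInf {s : ℕ | HasKraus N s}

/-- The trace norm (Schatten 1-norm): the sum of the singular values. -/
noncomputable def traceNorm {B : Type*} [Fintype B] [DecidableEq B] (X : Matrix B B ℂ) : ℝ :=
  ∑ i, √((Matrix.isHermitian_conjTranspose_mul_self X).eigenvalues i)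

/-- The operator inequalities
`-ε (N ρ + 1/|B|) ≤ M ρ - N ρ ≤ ε (N ρ + 1/|B|)` (Loewner order) for all states `ρ`. -/
def Sandwich {A B : Type*} [Fintype A] [Fintype B] [DecidableEq B]
    (N M : Matrix A A ℂ →ₗ[ℂ] Matrix B B ℂ) (ε : ℝ) : Prop :=
  ∀ ρ : Matrix A A ℂ, IsState ρ →
    -(ε • (N ρ + (Fintype.card B : ℝ)⁻¹ • (1 : Matrix B B ℂ))) ≤ M ρ - N ρ ∧
    M ρ - N ρ ≤ ε • (N ρ + (Fintype.card B : ℝ)⁻¹ • (1 : Matrix B B ℂ))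

/-- The partial trace over the second factor. -/
def partialTrace {B E : Type*} [Fintype E] (M : Matrix (B × E) (B × E) ℂ) : Matrix B B ℂ :=
  Matrix.of fun b b' => ∑ e, M (b, e) (b', e)

/-- `V` is a Stinespring isometry of `N` with environment `ℂ^s`. -/
def IsStinespring {A B : Type*} [Fintype A] [DecidableEq A] [Fintype B] {s : ℕ}
    (V : Matrix (B × Fin s) A ℂ) (N : Matrix A A ℂ →ₗ[ℂ] Matrix B B ℂ) : Prop :=
  Vᴴ * V = 1 ∧ ∀ X : Matrix A A ℂ, N X = partialTrace (V * X * Vᴴ)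

/-- The unit sphere of `ℂ^s`. -/
abbrev UnitSphere (s : ℕ) : Type :=
  Metric.sphere (0 : EuclideanSpace ℂ (Fin s)) 1

/-- The rank-one projector onto the line spanned by a unit vector. -/
def proj {s : ℕ} (φ : UnitSphere s) : Matrix (Fin s) (Fin s) ℂ :=
  Matrix.vecMulVec (fun i => φ.1 i) (fun i => star (φ.1 i))

/-- `X ↦ s · tr_E [(1 ⊗ φ) V X V† (1 ⊗ φ)]` for a unit vector `φ` of the environment `ℂ^s`. -/
def envMap {A B : Type*} [Fintype A] [Fintype B] [DecidableEq B] {s : ℕ}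
    (V : Matrix (B × Fin s) A ℂ) (φ : UnitSphere s) : Matrix A A ℂ →ₗ[ℂ] Matrix B B ℂ where
  toFun X := (s : ℂ) • partialTrace
    (((1 : Matrix B B ℂ) ⊗ₖ proj φ) * (V * X * Vᴴ) * ((1 : Matrix B B ℂ) ⊗ₖ proj φ))
  map_add' X Y := by
    ext b b'
    simp [partialTrace, Matrix.mul_add, Matrix.add_mul, Finset.sum_add_distrib, mul_add]
  map_smul' c X := by
    ext b b'
    simp [partialTrace, ← Finset.mul_sum, mul_left_comm]

/-- The average of the maps `envMap V (φ i)` over `n` environment vectors. -/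
noncomputable def sampledMap {A B : Type*} [Fintype A] [Fintype B] [DecidableEq B] {s n : ℕ}
    (V : Matrix (B × Fin s) A ℂ) (φ : Fin n → UnitSphere s) :
    Matrix A A ℂ →ₗ[ℂ] Matrix B B ℂ :=
  (n : ℂ)⁻¹ • ∑ i, envMap V (φ i)

/-- Lebesgue measure on `ℂ^s` (the product measure, transported to the Euclidean norm). -/
noncomputable def lebesgue (s : ℕ) : MeasureTheory.Measure (EuclideanSpace ℂ (Fin s)) :=
  (MeasureTheory.volume : MeasureTheory.Measure (Fin s → ℂ)).map (WithLp.toLp 2)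

/-- The uniform probability measure on the unit sphere of `ℂ^s`: normalized surface measure. -/
noncomputable def uniformSphere (s : ℕ) : MeasureTheory.Measure (UnitSphere s) :=
  ((lebesgue s).toSphere Set.univ)⁻¹ • (lebesgue s).toSphere

/-- The law of `n` independent uniformly distributed unit vectors of `ℂ^s`. -/
noncomputable def iidUniform (s n : ℕ) : MeasureTheory.Measure (Fin n → UnitSphere s) :=
  MeasureTheory.Measure.pi fun _ => uniformSphere s

end ChannelCompression

/-! For vectors x, y let v = (⟨y| ⊗ 1) V x, a vector of the environment. The quadratic form of
N(xx†) at y is ‖v‖², and that of the sampled map is the empirical mean of s|⟨v, φᵢ⟩|², whose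
expectation is ‖v‖². The sandwich is thus a uniform law of large numbers over the vectors v that
come from pairs (x, y).

For a single unit vector u, the volume of an ellipsoid in polar coordinates gives E(1 - ct)⁻ˢ = (1 -
c)⁻¹ for t = |⟨u, φ⟩|². So st has the moment generating function of an exponential variable as an
upper bound (`integral_exp_uniformSphere_le`), and Chernoff bounds the probability of a relative
error above ε by 2 exp(-nε²/4) (`iidUniform_deviation_le`). This error is relative to ‖v‖², so s
does not enter it.

Grids in the unit balls of A and B, with mesh polynomial in ε/s, have exp(O(D log(s/ε))) points,
where D = max(|A|, |B|). A union bound over pairs of grid points then succeeds for n of order D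
log(s/ε)/ε². Leaving the grid costs a small additive error, absorbed by the identity term ε/|B|
(`abs_deviation_envVec_le_of_net`).

A Hermitian matrix between -P and P has trace norm at most tr P, here 2ε. Trace preservation is
restored by shrinking the map until it is trace non-increasing and returning the lost trace through
a measure-and-prepare map with |A| Kraus operators (`Sandwich.exists_isTP`). -/

namespace ChannelCompression

open MeasureTheory Metric Set

/-! ### Exponential moments of overlaps on the complex sphere -/

section Sphere

/-- Polar coordinates applied to the preimage of the unit ball under an invertible linear map. -/
theorem lintegral_toSphere_inv_norm_pow {E : Type*} [NormedAddCommGroup E] [NormedSpace ℝ E]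
    [MeasurableSpace E] [BorelSpace E] [FiniteDimensional ℝ E] [Nontrivial E]
    (μ : Measure E) [μ.IsAddHaarMeasure] (T : E →ₗ[ℝ] E) (hT : LinearMap.det T ≠ 0) :
    ∫⁻ φ, ENNReal.ofReal ((‖T φ.1‖⁻¹) ^ Module.finrank ℝ E) ∂μ.toSphere =
      ENNReal.ofReal |(LinearMap.det T)⁻¹| * μ.toSphere univ := by
  have hd : 0 < Module.finrank ℝ E := Module.finrank_pos
  have hinj : Function.Injective T := (LinearMap.equivOfDetNeZero T hT).injective
  have hTc : Continuous T := T.continuous_of_finiteDimensional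
  have hpos : ∀ φ : sphere (0 : E) 1, 0 < ‖T φ.1‖ := by
    intro φ
    rw [norm_pos_iff, Ne, map_eq_zero_iff T hinj]
    exact ne_zero_of_mem_unit_sphere φ
  have hvol : μ (T ⁻¹' ball 0 1) = ENNReal.ofReal |(LinearMap.det T)⁻¹| * μ (ball 0 1) :=
    Measure.addHaar_preimage_linearMap μ hT _
  have hmeas : MeasurableSet (T ⁻¹' ball 0 1) := (isOpen_ball.preimage hTc).measurableSet
  -- In direction φ the preimage of the ball has radius ‖Tφ‖⁻¹. Its volume is computed twice:
  -- radially over the sphere, and by the determinant.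
  set S : Set (sphere (0 : E) 1 × Ioi (0 : ℝ)) := {p | p.2.1 < ‖T p.1.1‖⁻¹} with hS
  have hSm : MeasurableSet S := by
    apply measurableSet_lt
    · fun_prop
    · have : Measurable fun φ : sphere (0 : E) 1 => ‖T φ.1‖⁻¹ :=
        (hTc.comp continuous_subtype_val).norm.measurable.inv
      exact this.comp measurable_fst
  have hpre : (homeomorphUnitSphereProd E) ⁻¹' S =
      (Subtype.val : ({0}ᶜ : Set E) → E) ⁻¹' (T ⁻¹' ball 0 1) := by
    ext x
    have hx : 0 < ‖x.1‖ := norm_pos_iff.2 x.2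
    simp only [hS, mem_preimage, mem_ofPred_eq, homeomorphUnitSphereProd_apply_fst_coe,
      homeomorphUnitSphereProd_apply_snd_coe, map_smul, norm_smul, norm_inv, norm_norm, mem_ball,
      dist_zero_right, mul_inv, inv_inv]
    have hTx : 0 < ‖T x.1‖ := by
      rw [norm_pos_iff, Ne, map_eq_zero_iff T hinj]; exact x.2
    rw [lt_mul_iff_one_lt_right hx, one_lt_inv₀ hTx]
  have h1 : μ (T ⁻¹' ball 0 1) =
      (μ.toSphere.prod (Measure.volumeIoiPow (Module.finrank ℝ E - 1))) S := by
    rw [← (μ.measurePreserving_homeomorphUnitSphereProd).measure_preimage hSm.nullMeasurableSet,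
      hpre, comap_subtype_coe_apply (measurableSet_singleton _).compl,
      Subtype.image_preimage_coe, inter_comm, ← sdiff_eq, measure_sdiff_null (measure_singleton _)]
  rw [Measure.prod_apply hSm] at h1
  have h2 : ∀ φ : sphere (0 : E) 1,
      ENNReal.ofReal ((‖T φ.1‖⁻¹) ^ Module.finrank ℝ E) = (Module.finrank ℝ E : ENNReal) *
      Measure.volumeIoiPow (Module.finrank ℝ E - 1) (Prod.mk φ ⁻¹' S) := by
    intro φ
    have : Prod.mk φ ⁻¹' S = Iio (⟨‖T φ.1‖⁻¹, mem_Ioi.2 (inv_pos.2 (hpos φ))⟩ : Ioi (0 : ℝ)) := by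
      ext r; simp [hS, ← Subtype.coe_lt_coe]
    rw [this, Measure.volumeIoiPow_apply_Iio, Nat.sub_add_cancel hd, Nat.cast_pred hd,
      sub_add_cancel, ← ENNReal.ofReal_natCast, ← ENNReal.ofReal_mul (Nat.cast_nonneg _),
      mul_div_cancel₀]
    exact (Nat.cast_pos.2 hd).ne'
  simp_rw [h2]
  rw [lintegral_const_mul' _ _ (ENNReal.natCast_ne_top _), ← h1, hvol, Measure.toSphere_apply_univ]
  ring

instance lebesgue.instIsAddHaarMeasure (s : ℕ) : (lebesgue s).IsAddHaarMeasure :=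
  (PiLp.continuousLinearEquiv 2 ℝ (fun _ : Fin s => ℂ)).symm.isAddHaarMeasure_map volume

theorem isProbabilityMeasure_uniformSphere {s : ℕ} (hs : 0 < s) :
    IsProbabilityMeasure (uniformSphere s) := by
  have : Nonempty (Fin s) := ⟨⟨0, hs⟩⟩
  refine ⟨?_⟩
  simp only [uniformSphere, Measure.smul_apply, smul_eq_mul]
  exact ENNReal.inv_mul_cancel
    (Measure.measure_univ_ne_zero.2 (Measure.toSphere_ne_zero (lebesgue s))) (measure_ne_top _ _)

/-- Exact form of a moment generating function: `E (1 - c t)⁻ˢ = (1 - c)⁻¹`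
for `t = |⟨u, φ⟩|²`. -/
theorem lintegral_uniformSphere_inv_pow {s : ℕ} (hs : 0 < s) (u : EuclideanSpace ℂ (Fin s))
    (hu : ‖u‖ = 1) {c : ℝ} (hc : c < 1) :
    ∫⁻ φ, ENNReal.ofReal ((1 - c * ‖inner ℂ u φ.1‖ ^ 2)⁻¹ ^ s) ∂uniformSphere s =
      ENNReal.ofReal (1 - c)⁻¹ := by
  have : Nonempty (Fin s) := ⟨⟨0, hs⟩⟩
  have h1c : 0 < 1 - c := by linarith
  -- T scales the line of u by √(1 - c) and fixes its orthogonal complement, so ‖Tφ‖² = 1 - c|⟨u,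
  -- φ⟩|². The real determinant is the squared modulus of the complex one, and the real dimension is
  -- 2s.
  set r : ℂ := ((√(1 - c) - 1 : ℝ) : ℂ) with hr
  set T : EuclideanSpace ℂ (Fin s) →ₗ[ℂ] EuclideanSpace ℂ (Fin s) :=
    LinearMap.transvection (innerₛₗ ℂ u) (r • u) with hTdef
  have hdetC : LinearMap.det T = ((√(1 - c) : ℝ) : ℂ) := by
    rw [hTdef, LinearMap.transvection.det]
    simp [inner_self_eq_norm_sq_to_K, hu, hr]
  have hdet : LinearMap.det (T.restrictScalars ℝ) = 1 - c := by
    rw [LinearMap.det_restrictScalars, hdetC, Algebra.norm_complex_apply, Complex.normSq_ofReal,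
      Real.mul_self_sqrt h1c.le]
  have hnorm : ∀ x, ‖T x‖ ^ 2 = ‖x‖ ^ 2 - c * ‖inner ℂ u x‖ ^ 2 := by
    intro x
    have hx : T x = x + (inner ℂ u x * r) • u := by
      simp [hTdef, LinearMap.transvection, smul_smul]
    have hre : RCLike.re (inner ℂ x ((inner ℂ u x * r) • u)) =
        (√(1 - c) - 1) * ‖inner ℂ u x‖ ^ 2 := by
      rw [inner_smul_right, ← inner_conj_symm x u, mul_right_comm, Complex.mul_conj', hr,
        ← Complex.ofReal_pow, ← Complex.ofReal_mul, RCLike.re_to_complex, Complex.ofReal_re,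
        mul_comm]
    rw [hx, norm_add_sq (𝕜 := ℂ), hre, norm_smul, hu, mul_one, norm_mul, hr, Complex.norm_real,
      mul_pow, Real.norm_eq_abs, sq_abs]
    nlinarith [Real.sq_sqrt h1c.le]
  have hfin : Module.finrank ℝ (EuclideanSpace ℂ (Fin s)) = 2 * s := by
    rw [← Module.finrank_mul_finrank ℝ ℂ, Complex.finrank_real_complex]; simp
  have key := lintegral_toSphere_inv_norm_pow (lebesgue s) (T.restrictScalars ℝ)
    (by rw [hdet]; exact h1c.ne')
  rw [hdet, abs_of_pos (inv_pos.2 h1c), hfin] at key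
  have hint : ∀ φ : UnitSphere s, ‖(T.restrictScalars ℝ) φ.1‖⁻¹ ^ (2 * s) =
      (1 - c * ‖inner ℂ u φ.1‖ ^ 2)⁻¹ ^ s := by
    intro φ
    rw [pow_mul, inv_pow, LinearMap.restrictScalars_apply, hnorm, norm_eq_of_mem_sphere, one_pow]
  simp_rw [hint] at key
  rw [uniformSphere, lintegral_smul_measure, key, smul_eq_mul, mul_left_comm,
    ENNReal.inv_mul_cancel
    (Measure.measure_univ_ne_zero.2 (Measure.toSphere_ne_zero (lebesgue s))) (measure_ne_top _ _),
    mul_one]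

theorem integrable_exp_uniformSphere {s : ℕ} (hs : 0 < s) (u : EuclideanSpace ℂ (Fin s)) (c : ℝ) :
    Integrable (fun φ : UnitSphere s => Real.exp (c * ‖inner ℂ u φ.1‖ ^ 2)) (uniformSphere s) := by
  have := isProbabilityMeasure_uniformSphere hs
  exact Continuous.integrable_of_hasCompactSupport (by fun_prop) (.of_compactSpace _)

/-- The overlap `s |⟨u, φ⟩|²` of a uniformly random unit vector with a fixed one
has an exponentially dominated moment generating function. -/
theorem integral_exp_uniformSphere_le {s : ℕ} (hs : 0 < s) (u : EuclideanSpace ℂ (Fin s))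
    (hu : ‖u‖ = 1) {c : ℝ} (hc : c < 1) :
    ∫ φ, Real.exp (c * (s * ‖inner ℂ u φ.1‖ ^ 2)) ∂uniformSphere s ≤ (1 - c)⁻¹ := by
  have h1c : 0 < 1 - c := by linarith
  rw [integral_eq_lintegral_of_nonneg_ae (.of_forall fun _ => (Real.exp_pos _).le)
    (by simpa [mul_assoc] using (integrable_exp_uniformSphere hs u (c * s)).1)]
  refine ENNReal.toReal_le_of_le_ofReal (inv_pos.2 h1c).le ?_
  rw [← lintegral_uniformSphere_inv_pow hs u hu hc]
  refine lintegral_mono fun φ => ENNReal.ofReal_le_ofReal ?_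
  set t := ‖inner ℂ u φ.1‖ ^ 2
  have ht0 : 0 ≤ t := by positivity
  have ht1 : t ≤ 1 := by
    have := norm_inner_le_norm (𝕜 := ℂ) u φ.1
    rw [hu, norm_eq_of_mem_sphere, one_mul] at this
    exact pow_le_one₀ (norm_nonneg _) this
  have hpos : 0 < 1 - c * t := by
    rcases le_total c 0 with h | h <;> nlinarith
  have : Real.exp (c * t) ≤ (1 - c * t)⁻¹ := by
    rw [le_inv_comm₀ (Real.exp_pos _) hpos, ← Real.exp_neg]
    linarith [Real.add_one_le_exp (-(c * t))]
  calc Real.exp (c * (s * t)) = Real.exp (c * t) ^ s := by rw [← Real.exp_nat_mul]; ring_nf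
    _ ≤ _ := by gcongr

end Sphere

/-! ### Chernoff bounds for empirical overlaps -/

section Concentration

/-- Centring the overlap at its mean 1 contributes e⁻ᶜ, which cancels the linear term of (1 - c)⁻¹
and leaves a sub-Gaussian exponent. -/
theorem exp_neg_mul_inv_one_sub_le {c : ℝ} (h : |c| ≤ 1 / 2) :
    Real.exp (-c) * (1 - c)⁻¹ ≤ Real.exp (c ^ 2) := by
  obtain ⟨h1, h2⟩ := abs_le.1 h
  have hpos : 0 < 1 - c := by linarith
  have : Real.exp (-c - c ^ 2) ≤ 1 - c := by
    rw [show -c - c ^ 2 = -(c + c ^ 2) by ring, Real.exp_neg,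
      inv_le_iff_one_le_mul₀ (Real.exp_pos _)]
    -- For c ≤ 0, first order suffices since (1 - c)(1 + c + c²) = 1 - c³ ≥ 1; for c ≥ 0 the
    -- quadratic term of exp is needed.
    rcases le_total c 0 with h | h
    · nlinarith [Real.add_one_le_exp (c + c ^ 2), pow_nonneg (neg_nonneg.2 h) 3]
    · have := Real.quadratic_le_exp_of_nonneg (x := c + c ^ 2) (by positivity)
      have h3 : 0 ≤ c ^ 2 * ((1 - c) * (1 + c) ^ 2 / 2 - c) := by
        apply mul_nonneg (sq_nonneg c)
        nlinarith [sq_nonneg c, mul_nonneg h h]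
      nlinarith
  rw [← div_eq_mul_inv, div_le_iff₀ hpos]
  calc Real.exp (-c) = Real.exp (c ^ 2) * Real.exp (-c - c ^ 2) := by
        rw [← Real.exp_add]; ring_nf
    _ ≤ _ := by gcongr

variable {s : ℕ}

/-- Exponential moments of the sum of `n` independent overlaps. -/
theorem integral_exp_iidUniform_le (hs : 0 < s) (n : ℕ) (u : EuclideanSpace ℂ (Fin s))
    (hu : ‖u‖ = 1) {c : ℝ} (hc : |c| ≤ 1 / 2) :
    ∫ φ, Real.exp (c * ∑ i, (s * ‖inner ℂ u (φ i).1‖ ^ 2 - 1)) ∂iidUniform s n ≤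
      Real.exp (n * c ^ 2) := by
  have := isProbabilityMeasure_uniformSphere hs
  have h1 : ∀ φ : Fin n → UnitSphere s,
      Real.exp (c * ∑ i, (s * ‖inner ℂ u (φ i).1‖ ^ 2 - 1)) =
        ∏ i, (Real.exp (-c) * Real.exp (c * (s * ‖inner ℂ u (φ i).1‖ ^ 2))) := by
    intro φ
    rw [Finset.mul_sum, Real.exp_sum]
    refine Finset.prod_congr rfl fun i _ => ?_
    rw [← Real.exp_add]; ring_nf
  simp_rw [h1]
  rw [iidUniform, integral_fintype_prod_eq_pow (ι := Fin n)
    (f := fun φ : UnitSphere s => Real.exp (-c) * Real.exp (c * (s * ‖inner ℂ u φ.1‖ ^ 2))),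
    integral_const_mul, Fintype.card_fin, Real.exp_nat_mul]
  refine pow_le_pow_left₀ (mul_nonneg (Real.exp_pos _).le
    (integral_nonneg fun _ => (Real.exp_pos _).le)) ?_ _
  refine le_trans ?_ (exp_neg_mul_inv_one_sub_le hc)
  exact mul_le_mul_of_nonneg_left (integral_exp_uniformSphere_le hs u hu
    (by linarith [(abs_le.1 hc).2])) (Real.exp_pos _).le

/-- Markov's inequality for the exponential; the sign of c selects the upper or the lower tail. -/
theorem iidUniform_tail_le (hs : 0 < s) (n : ℕ) (u : EuclideanSpace ℂ (Fin s))
    (hu : ‖u‖ = 1) {c a : ℝ} (hc : |c| ≤ 1 / 2) :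
    (iidUniform s n).real {φ | a ≤ c * ∑ i, (s * ‖inner ℂ u (φ i).1‖ ^ 2 - 1)} ≤
      Real.exp (n * c ^ 2 - a) := by
  have := isProbabilityMeasure_uniformSphere hs
  have : IsProbabilityMeasure (iidUniform s n) := by unfold iidUniform; infer_instance
  have hint : Integrable (fun φ : Fin n → UnitSphere s =>
      Real.exp (c * ∑ i, (s * ‖inner ℂ u (φ i).1‖ ^ 2 - 1))) (iidUniform s n) :=
    Continuous.integrable_of_hasCompactSupport (by fun_prop) (.of_compactSpace _)
  have h := mul_meas_ge_le_integral_of_nonneg (.of_forall fun _ => (Real.exp_pos _).le) hint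
    (Real.exp a)
  simp only [Real.exp_le_exp] at h
  rw [Real.exp_sub, le_div_iff₀ (Real.exp_pos _), mul_comm]
  exact h.trans (integral_exp_iidUniform_le hs n u hu hc)

/-- Concentration of the empirical mean of the overlaps of random unit vectors with a fixed one. -/
theorem iidUniform_deviation_le (hs : 0 < s) (n : ℕ) (v : EuclideanSpace ℂ (Fin s))
    {ε : ℝ} (hε : 0 < ε) (hε1 : ε ≤ 1) :
    (iidUniform s n).real
      {φ | n * (ε * ‖v‖ ^ 2) < |∑ i, (s * ‖inner ℂ v (φ i).1‖ ^ 2 - ‖v‖ ^ 2)|} ≤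
      2 * Real.exp (-(n * ε ^ 2 / 4)) := by
  have := isProbabilityMeasure_uniformSphere hs
  have : IsProbabilityMeasure (iidUniform s n) := by unfold iidUniform; infer_instance
  rcases eq_or_ne v 0 with rfl | hv
  · simpa using (Real.exp_pos _).le
  have hv0 : 0 < ‖v‖ := norm_pos_iff.2 hv
  set u : EuclideanSpace ℂ (Fin s) := ((‖v‖⁻¹ : ℝ) : ℂ) • v with hu
  have hu1 : ‖u‖ = 1 := by simp [hu, norm_smul, hv0.ne']
  have hvu : ∀ x, ‖inner ℂ v x‖ ^ 2 = ‖v‖ ^ 2 * ‖inner ℂ u x‖ ^ 2 := by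
    intro x
    rw [hu, inner_smul_left, norm_mul]
    simp [mul_pow]
    field_simp
  have hsub : {φ : Fin n → UnitSphere s |
      n * (ε * ‖v‖ ^ 2) < |∑ i, (s * ‖inner ℂ v (φ i).1‖ ^ 2 - ‖v‖ ^ 2)|} ⊆
      {φ | n * ε ^ 2 / 2 ≤ ε / 2 * ∑ i, (s * ‖inner ℂ u (φ i).1‖ ^ 2 - 1)} ∪
      {φ | n * ε ^ 2 / 2 ≤ -(ε / 2) * ∑ i, (s * ‖inner ℂ u (φ i).1‖ ^ 2 - 1)} := by
    intro φ hφ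
    simp only [mem_ofPred_eq, mem_union] at hφ ⊢
    have : ∑ i, (s * ‖inner ℂ v (φ i).1‖ ^ 2 - ‖v‖ ^ 2) =
        ‖v‖ ^ 2 * ∑ i, (s * ‖inner ℂ u (φ i).1‖ ^ 2 - 1) := by
      rw [Finset.mul_sum]
      refine Finset.sum_congr rfl fun i _ => ?_
      rw [hvu]; ring
    rw [this, abs_mul, abs_of_pos (by positivity), ← mul_assoc, mul_comm,
      mul_lt_mul_iff_right₀ (by positivity)] at hφ
    rcases lt_abs.1 hφ with h | h
    · left; nlinarith
    · right; nlinarith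
  refine (measureReal_mono hsub).trans ((measureReal_union_le _ _).trans ?_)
  -- The choice |c| = ε/2 minimises the exponent nc² - nε|c|, with value -nε²/4.
  have h1 := iidUniform_tail_le hs n u hu1 (c := ε / 2) (a := n * ε ^ 2 / 2)
    (by rw [abs_of_pos] <;> linarith)
  have h2 := iidUniform_tail_le hs n u hu1 (c := -(ε / 2)) (a := n * ε ^ 2 / 2)
    (by rw [abs_neg, abs_of_pos] <;> linarith)
  have e : n * (ε / 2) ^ 2 - n * ε ^ 2 / 2 = -(n * ε ^ 2 / 4) := by ring
  rw [e] at h1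
  rw [neg_sq, e] at h2
  linarith

end Concentration

end ChannelCompression

namespace ChannelCompression

open Matrix

/-! ### Trace norm of Hermitian matrices -/

section TraceNorm

variable {B : Type*} [Fintype B] [DecidableEq B]

/-- The characteristic polynomial of D†D, read off the spectral decomposition of D, has roots |λᵢ|².
Comparing multisets of roots avoids matching the two orderings of eigenvalues. -/
theorem traceNorm_eq_sum_abs_eigenvalues {D : Matrix B B ℂ} (hD : D.IsHermitian) :
    traceNorm D = ∑ i, |hD.eigenvalues i| := by
  set H := isHermitian_conjTranspose_mul_self D
  set U : Matrix B B ℂ := hD.eigenvectorUnitary.1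
  have hU : star U * U = 1 := Unitary.coe_star_mul_self hD.eigenvectorUnitary
  have hDspec : D = U * diagonal (fun i => (hD.eigenvalues i : ℂ)) * star U := hD.spectral_theorem
  have hsq : Dᴴ * D = U * diagonal (fun i => ((|hD.eigenvalues i| ^ 2 : ℝ) : ℂ)) * star U := by
    rw [hD.eq]
    conv_lhs => rw [hDspec]
    calc _ = U * diagonal (fun i => (hD.eigenvalues i : ℂ)) * (star U * U) *
          diagonal (fun i => (hD.eigenvalues i : ℂ)) * star U := by simp only [Matrix.mul_assoc]
      _ = _ := by
        rw [hU, Matrix.mul_one, Matrix.mul_assoc U, diagonal_mul_diagonal]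
        simp [sq]
  have hroots := H.roots_charpoly_eq_eigenvalues
  have hchar : (Dᴴ * D).charpoly =
      ∏ i, (Polynomial.X - Polynomial.C ((|hD.eigenvalues i| ^ 2 : ℝ) : ℂ)) := by
    rw [hsq, charpoly_mul_comm, ← Matrix.mul_assoc, hU, Matrix.one_mul, charpoly_diagonal]
  rw [hchar,
    Polynomial.roots_prod _ _ (Finset.prod_ne_zero_iff.2 fun i _ => Polynomial.X_sub_C_ne_zero _)]
    at hroots
  have h2 := congrArg (fun m => (m.map fun z : ℂ => √z.re).sum) hroots
  simp only [Polynomial.roots_X_sub_C, Multiset.bind_singleton, Multiset.map_map,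
    Function.comp_apply, Complex.ofReal_re] at h2
  unfold traceNorm
  simpa [Real.sqrt_sq_eq_abs] using h2.symm

/-- A matrix squeezed between `-P` and `P` has trace norm at most `tr P`. -/
theorem traceNorm_le_trace {D P : Matrix B B ℂ} (h1 : -P ≤ D) (h2 : D ≤ P) :
    traceNorm D ≤ P.trace.re := by
  have hD : D.IsHermitian := by
    have a := (Matrix.le_iff.1 h1).isHermitian
    have b := (Matrix.le_iff.1 h2).isHermitian
    have c : D = (2⁻¹ : ℝ) • ((D - -P) - (P - D)) := by
      rw [show (D - -P) - (P - D) = (2 : ℝ) • D by rw [two_smul]; abel, smul_smul]; norm_num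
    rw [c]
    exact (a.sub b).smul (IsSelfAdjoint.all _)
  rw [traceNorm_eq_sum_abs_eigenvalues hD]
  set U : Matrix B B ℂ := hD.eigenvectorUnitary.1
  have hU : U * star U = 1 := Unitary.coe_mul_star_self hD.eigenvectorUnitary
  have htr : P.trace.re = ∑ i, (star ⇑(hD.eigenvectorBasis i) ⬝ᵥ
      (P *ᵥ ⇑(hD.eigenvectorBasis i))).re := by
    have : P.trace = (star U * P * U).trace := by
      rw [Matrix.trace_mul_comm, ← Matrix.mul_assoc, hU, Matrix.one_mul]
    rw [this, Matrix.trace, Complex.re_sum]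
    refine Finset.sum_congr rfl fun i _ => ?_
    rw [Matrix.diag_apply, Matrix.mul_assoc]
    rfl
  rw [htr]
  -- In the eigenbasis of D each eigenvalue is a diagonal entry of D, hence bounded in modulus by
  -- the same diagonal entry of P.
  refine Finset.sum_le_sum fun i _ => ?_
  rw [hD.eigenvalues_eq, abs_le]
  have p1 := (Complex.le_def.1
    ((Matrix.le_iff.1 h1).dotProduct_mulVec_nonneg ⇑(hD.eigenvectorBasis i))).1
  have p2 := (Complex.le_def.1
    ((Matrix.le_iff.1 h2).dotProduct_mulVec_nonneg ⇑(hD.eigenvectorBasis i))).1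
  simp only [Matrix.sub_mulVec, Matrix.neg_mulVec, dotProduct_sub, dotProduct_neg, Complex.sub_re,
    Complex.neg_re, Complex.zero_re] at p1 p2
  constructor <;> simp only [RCLike.re_to_complex] <;> linarith

end TraceNorm

/-! ### Kraus decompositions -/

section Kraus

variable {A B : Type*} [Fintype A]

theorem HasKraus.krausRank_le {N : Matrix A A ℂ →ₗ[ℂ] Matrix B B ℂ} {n : ℕ} (h : HasKraus N n) :
    krausRank N ≤ n := Nat.sInf_le h

/-- Positivity rules out the default `sInf ∅ = 0`, so the infimum is attained. In the theorem the
rank is at least |A| > 0, which is how N receives its Kraus operators. -/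
theorem hasKraus_krausRank {N : Matrix A A ℂ →ₗ[ℂ] Matrix B B ℂ} (h : 0 < krausRank N) :
    HasKraus N (krausRank N) := by
  refine Nat.sInf_mem (s := {s : ℕ | HasKraus N s}) ?_
  by_contra hne
  rw [Set.not_nonempty_iff_eq_empty] at hne
  simp [krausRank, hne] at h

theorem HasKraus.isCP [Finite B] {N : Matrix A A ℂ →ₗ[ℂ] Matrix B B ℂ} {n : ℕ}
    (h : HasKraus N n) : IsCP N := by
  have := Fintype.ofFinite B
  obtain ⟨K, hK⟩ := h
  intro k X hX
  have : amplify k N X = ∑ i, ((1 : Matrix (Fin k) (Fin k) ℂ) ⊗ₖ K i) * X *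
      ((1 : Matrix (Fin k) (Fin k) ℂ) ⊗ₖ K i)ᴴ := by
    ext ⟨p, b⟩ ⟨q, b'⟩
    simp [amplify, hK, Matrix.sum_apply, Matrix.mul_apply, Fintype.sum_prod_type,
      Matrix.one_apply, Finset.sum_mul, ite_mul, apply_ite (starRingEnd ℂ)]
  rw [this]
  exact Matrix.posSemidef_sum _ fun i _ => hX.mul_mul_conjTranspose_same _

theorem HasKraus.add {N M : Matrix A A ℂ →ₗ[ℂ] Matrix B B ℂ} {m n : ℕ}
    (hN : HasKraus N m) (hM : HasKraus M n) : HasKraus (N + M) (m + n) := by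
  obtain ⟨K, hK⟩ := hN
  obtain ⟨J, hJ⟩ := hM
  refine ⟨Fin.append K J, fun X => ?_⟩
  simp [hK, hJ, Fin.sum_univ_add]

theorem HasKraus.smul {N : Matrix A A ℂ →ₗ[ℂ] Matrix B B ℂ} {n : ℕ}
    (hN : HasKraus N n) {c : ℝ} (hc : 0 ≤ c) : HasKraus ((c : ℂ) • N) n := by
  obtain ⟨K, hK⟩ := hN
  refine ⟨fun i => ((√c : ℝ) : ℂ) • K i, fun X => ?_⟩
  simp [hK, Finset.smul_sum, smul_smul, Real.mul_self_sqrt hc]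

theorem hasKraus_zero : HasKraus (0 : Matrix A A ℂ →ₗ[ℂ] Matrix B B ℂ) 0 :=
  ⟨Fin.elim0, fun X => by simp⟩

variable [Fintype B]

/-- The quadratic form of the image of a positive matrix under a map in Kraus form. -/
theorem dotProduct_kraus_mulVec {ι : Type*} [Fintype ι] (K : ι → Matrix B A ℂ) {J : Type*}
    [Fintype J] (L : Matrix A J ℂ) (y : B → ℂ) :
    star y ⬝ᵥ ((∑ i, K i * (L * Lᴴ) * (K i)ᴴ) *ᵥ y) =
      ((∑ j, ∑ i, ‖star y ⬝ᵥ (K i *ᵥ L.col j)‖ ^ 2 : ℝ) : ℂ) := by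
  rw [Matrix.sum_mulVec, dotProduct_sum, Finset.sum_comm]
  push_cast
  refine Finset.sum_congr rfl fun i _ => ?_
  have h : K i * (L * Lᴴ) * (K i)ᴴ = (K i * L) * (K i * L)ᴴ := by
    rw [conjTranspose_mul]; simp only [Matrix.mul_assoc]
  rw [h, ← Matrix.mulVec_mulVec, dotProduct_mulVec]
  have h2 : (K i * L)ᴴ *ᵥ y = star (star y ᵥ* (K i * L)) := by
    rw [Matrix.star_vecMul, star_star]
  rw [h2, dotProduct]
  refine Finset.sum_congr rfl fun j _ => ?_
  have h3 : (star y ᵥ* (K i * L)) j = star y ⬝ᵥ (K i *ᵥ L.col j) := rfl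
  rw [Pi.star_apply, h3, ← Complex.mul_conj']; rfl

theorem HasKraus.posSemidef_apply {N : Matrix A A ℂ →ₗ[ℂ] Matrix B B ℂ} {n : ℕ} (h : HasKraus N n)
    {X : Matrix A A ℂ} (hX : X.PosSemidef) : (N X).PosSemidef := by
  obtain ⟨K, hK⟩ := h
  rw [hK]
  exact Matrix.posSemidef_sum _ fun i _ => hX.mul_mul_conjTranspose_same _

end Kraus

theorem star_dotProduct_self_eq_sum {ι : Type*} [Fintype ι] (z : ι → ℂ) :
    star z ⬝ᵥ z = ((∑ i, ‖z i‖ ^ 2 : ℝ) : ℂ) := by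
  push_cast
  exact Finset.sum_congr rfl fun b _ => Complex.conj_mul' _

/-! ### Reduction of the operator inequalities to vectors -/

section Sandwich

variable {A B : Type*} [Fintype A] [Fintype B] [DecidableEq B]

/-- It is enough to check the operator inequalities on pure states and pure effects. -/
theorem sandwich_of_forall {ι κ : Type*} [Fintype ι] [Fintype κ]
    {N M : Matrix A A ℂ →ₗ[ℂ] Matrix B B ℂ} {ε : ℝ}
    (K : ι → Matrix B A ℂ) (J : κ → Matrix B A ℂ)
    (hN : ∀ X, N X = ∑ i, K i * X * (K i)ᴴ) (hM : ∀ X, M X = ∑ i, J i * X * (J i)ᴴ)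
    (h : ∀ (x : A → ℂ) (y : B → ℂ),
      |∑ i, ‖star y ⬝ᵥ (J i *ᵥ x)‖ ^ 2 - ∑ i, ‖star y ⬝ᵥ (K i *ᵥ x)‖ ^ 2| ≤
        ε * (∑ i, ‖star y ⬝ᵥ (K i *ᵥ x)‖ ^ 2 +
          (Fintype.card B : ℝ)⁻¹ * ((∑ a, ‖x a‖ ^ 2) * ∑ b, ‖y b‖ ^ 2))) :
    Sandwich N M ε := by
  classical
  rintro ρ ⟨hρ, htr⟩
  have hNH : (N ρ).IsHermitian := by
    rw [hN]; exact (Matrix.posSemidef_sum _ fun i _ => hρ.mul_mul_conjTranspose_same _).isHermitian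
  have hMH : (M ρ).IsHermitian := by
    rw [hM]; exact (Matrix.posSemidef_sum _ fun i _ => hρ.mul_mul_conjTranspose_same _).isHermitian
  -- The columns of L are unnormalised pure states summing to ρ, with squared norms summing to 1;
  -- the homogeneous inequality is added up over them.
  obtain ⟨L, hL⟩ : ∃ L : Matrix A A ℂ, ρ = L * Lᴴ := by
    obtain ⟨L, hL⟩ := CStarAlgebra.nonneg_iff_eq_star_mul_self.1 hρ.nonneg
    exact ⟨Lᴴ, by rw [conjTranspose_conjTranspose]; exact hL⟩
  have hLtr : ∑ j, ∑ a, ‖L a j‖ ^ 2 = 1 := by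
    rw [hL, Matrix.trace] at htr
    simp only [Matrix.diag_apply, Matrix.mul_apply, Matrix.conjTranspose_apply] at htr
    rw [Finset.sum_comm]
    have : ((∑ a, ∑ j, ‖L a j‖ ^ 2 : ℝ) : ℂ) = 1 := by
      rw [← htr]
      push_cast
      refine Finset.sum_congr rfl fun a _ => Finset.sum_congr rfl fun j _ => ?_
      rw [← Complex.mul_conj']; rfl
    exact_mod_cast this
  have hsum : ∀ y : B → ℂ,
      |∑ j, ∑ i, ‖star y ⬝ᵥ (J i *ᵥ L.col j)‖ ^ 2 - ∑ j, ∑ i, ‖star y ⬝ᵥ (K i *ᵥ L.col j)‖ ^ 2| ≤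
        ε * (∑ j, ∑ i, ‖star y ⬝ᵥ (K i *ᵥ L.col j)‖ ^ 2 +
          (Fintype.card B : ℝ)⁻¹ * ∑ b, ‖y b‖ ^ 2) := by
    intro y
    rw [← Finset.sum_sub_distrib]
    refine (Finset.abs_sum_le_sum_abs _ _).trans ((Finset.sum_le_sum fun j _ => h _ y).trans ?_)
    rw [← Finset.mul_sum, Finset.sum_add_distrib, ← Finset.mul_sum, ← Finset.sum_mul]
    simp only [Matrix.col_apply, hLtr, one_mul, le_refl]
  have hP : (ε • (N ρ + (Fintype.card B : ℝ)⁻¹ • (1 : Matrix B B ℂ))).IsHermitian :=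
    (hNH.add (Matrix.isHermitian_one.smul (IsSelfAdjoint.all _))).smul (IsSelfAdjoint.all _)
  have hNq : ∀ y, star y ⬝ᵥ (N ρ *ᵥ y) =
      ((∑ j, ∑ i, ‖star y ⬝ᵥ (K i *ᵥ L.col j)‖ ^ 2 : ℝ) : ℂ) := fun y => by
    rw [hN, hL, dotProduct_kraus_mulVec K L y]
  have hMq : ∀ y, star y ⬝ᵥ (M ρ *ᵥ y) =
      ((∑ j, ∑ i, ‖star y ⬝ᵥ (J i *ᵥ L.col j)‖ ^ 2 : ℝ) : ℂ) := fun y => by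
    rw [hM, hL, dotProduct_kraus_mulVec J L y]
  constructor
  · rw [Matrix.le_iff]
    refine .of_dotProduct_mulVec_nonneg ((hMH.sub hNH).sub hP.neg) fun y => ?_
    simp only [Matrix.sub_mulVec, Matrix.neg_mulVec, Matrix.add_mulVec, Matrix.smul_mulVec,
      dotProduct_sub, dotProduct_add, dotProduct_neg, dotProduct_smul, Matrix.one_mulVec,
      star_dotProduct_self_eq_sum,
      hNq, hMq, Complex.real_smul]
    norm_cast
    linarith [(abs_le.1 (hsum y)).1]
  · rw [Matrix.le_iff]
    refine .of_dotProduct_mulVec_nonneg (hP.sub (hMH.sub hNH)) fun y => ?_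
    simp only [Matrix.sub_mulVec, Matrix.add_mulVec, Matrix.smul_mulVec,
      dotProduct_sub, dotProduct_add, dotProduct_smul, Matrix.one_mulVec,
      star_dotProduct_self_eq_sum,
      hNq, hMq, Complex.real_smul]
    norm_cast
    linarith [(abs_le.1 (hsum y)).2]

end Sandwich

end ChannelCompression

namespace ChannelCompression

open Matrix

/-! ### Environment vectors and Kraus operators of the sampled map -/

section Stinespring

variable {A B : Type*} [Fintype A] [Fintype B] {s : ℕ}

/-- The Kraus operators `⟨e| V` attached to the standard basis of the environment. -/
def basisKraus (V : Matrix (B × Fin s) A ℂ) (e : Fin s) : Matrix B A ℂ :=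
  Matrix.of fun b a => V (b, e) a

omit [Fintype B] in
theorem partialTrace_eq_sum_basisKraus (V : Matrix (B × Fin s) A ℂ) (X : Matrix A A ℂ) :
    partialTrace (V * X * Vᴴ) = ∑ e, basisKraus V e * X * (basisKraus V e)ᴴ := by
  ext b b'
  simp [partialTrace, basisKraus, Matrix.sum_apply, Matrix.mul_apply]

/-- The Kraus operator `⟨φ| V` attached to an environment vector. -/
def envKraus (V : Matrix (B × Fin s) A ℂ) (φ : UnitSphere s) : Matrix B A ℂ :=
  ∑ e, star (φ.1 e) • basisKraus V e

theorem sum_mul_star_eq_one (φ : UnitSphere s) : ∑ e, φ.1 e * star (φ.1 e) = 1 := by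
  have h := EuclideanSpace.norm_sq_eq φ.1
  rw [norm_eq_of_mem_sphere, one_pow] at h
  have h2 : ((∑ e, ‖φ.1 e‖ ^ 2 : ℝ) : ℂ) = 1 := by rw [← h]; simp
  rw [← h2]
  push_cast
  exact Finset.sum_congr rfl fun e _ => Complex.mul_conj' _

/-- With F = 1 ⊗ |φ⟩, the projector is FF†, F†V is the Kraus operator, and tracing out the
environment of FYF† returns Y because φ is a unit vector. -/
theorem envMap_apply [DecidableEq B] (V : Matrix (B × Fin s) A ℂ) (φ : UnitSphere s)
    (X : Matrix A A ℂ) :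
    envMap V φ X = (s : ℂ) • (envKraus V φ * X * (envKraus V φ)ᴴ) := by
  set F : Matrix (B × Fin s) B ℂ := Matrix.of fun p b => if p.1 = b then φ.1 p.2 else 0 with hF
  have h1 : (1 : Matrix B B ℂ) ⊗ₖ proj φ = F * Fᴴ := by
    ext ⟨b, e⟩ ⟨b', e'⟩
    simp [hF, proj, Matrix.mul_apply, Matrix.vecMulVec_apply, Matrix.one_apply,
      apply_ite (starRingEnd ℂ), eq_comm]
  have h2 : Fᴴ * V = envKraus V φ := by
    ext b a
    simp [hF, envKraus, basisKraus, Matrix.mul_apply, Fintype.sum_prod_type, Matrix.sum_apply,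
      apply_ite (starRingEnd ℂ)]
  have h3 : ∀ Y : Matrix B B ℂ, partialTrace (F * Y * Fᴴ) = Y := by
    intro Y
    ext b b'
    have : ∀ e, (F * Y * Fᴴ) (b, e) (b', e) = φ.1 e * star (φ.1 e) * Y b b' := by
      intro e
      simp [hF, Matrix.mul_apply, apply_ite (starRingEnd ℂ)]
      ring
    simp only [partialTrace, Matrix.of_apply, this]
    rw [← Finset.sum_mul, sum_mul_star_eq_one, one_mul]
  have h4 : ((1 : Matrix B B ℂ) ⊗ₖ proj φ) * (V * X * Vᴴ) * ((1 : Matrix B B ℂ) ⊗ₖ proj φ) =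
      F * (envKraus V φ * X * (envKraus V φ)ᴴ) * Fᴴ := by
    rw [h1, ← h2, conjTranspose_mul, conjTranspose_conjTranspose]
    simp only [Matrix.mul_assoc]
  show (s : ℂ) • partialTrace _ = _
  rw [h4, h3]

/-- The Kraus operators of the sampled map. -/
noncomputable def sampledKraus {n : ℕ} (V : Matrix (B × Fin s) A ℂ) (φ : Fin n → UnitSphere s)
    (i : Fin n) : Matrix B A ℂ :=
  ((√(s / n) : ℝ) : ℂ) • envKraus V (φ i)

theorem sampledMap_apply [DecidableEq B] {n : ℕ} (V : Matrix (B × Fin s) A ℂ)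
    (φ : Fin n → UnitSphere s) (X : Matrix A A ℂ) :
    sampledMap V φ X = ∑ i, sampledKraus V φ i * X * (sampledKraus V φ i)ᴴ := by
  have h : ((√(s / n) : ℝ) : ℂ) * ((√(s / n) : ℝ) : ℂ) = (n : ℂ)⁻¹ * s := by
    rw [← Complex.ofReal_mul, Real.mul_self_sqrt (by positivity)]
    push_cast
    rw [mul_comm, div_eq_mul_inv]
  simp only [sampledMap, LinearMap.smul_apply, LinearMap.sum_apply, envMap_apply, Finset.smul_sum,
    sampledKraus, conjTranspose_smul, Matrix.smul_mul, Matrix.mul_smul, smul_smul]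
  refine Finset.sum_congr rfl fun i _ => ?_
  rw [← h]
  simp

theorem hasKraus_sampledMap [DecidableEq B] {n : ℕ} (V : Matrix (B × Fin s) A ℂ)
    (φ : Fin n → UnitSphere s) : HasKraus (sampledMap V φ) n :=
  ⟨sampledKraus V φ, sampledMap_apply V φ⟩

/-- A Stinespring isometry assembled from Kraus operators. -/
theorem HasKraus.exists_isStinespring [DecidableEq A] {N : Matrix A A ℂ →ₗ[ℂ] Matrix B B ℂ}
    (h : HasKraus N s) (hTP : IsTP N) :
    ∃ V : Matrix (B × Fin s) A ℂ, IsStinespring V N := by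
  obtain ⟨K, hK⟩ := h
  set V : Matrix (B × Fin s) A ℂ := Matrix.of fun p a => K p.2 p.1 a with hV
  have hN : ∀ X : Matrix A A ℂ, N X = partialTrace (V * X * Vᴴ) := by
    intro X
    rw [partialTrace_eq_sum_basisKraus, hK]
    rfl
  refine ⟨V, ?_, hN⟩
  ext a a'
  -- Trace preservation on a matrix unit reads off one entry of V†V.
  have h1 := hTP (Matrix.single a' a 1)
  have h2 : ∀ M : Matrix (B × Fin s) (B × Fin s) ℂ, (partialTrace M).trace = M.trace := by
    intro M
    simp [partialTrace, Matrix.trace, Fintype.sum_prod_type]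
  rw [hN, h2, Matrix.trace_mul_comm, ← Matrix.mul_assoc, Matrix.trace_mul_single,
    ← Matrix.one_mul (Matrix.single a' a 1), Matrix.trace_mul_single] at h1
  simpa using h1

/-- The environment vector `(⟨y| ⊗ 1) V x`. -/
noncomputable def envVec (V : Matrix (B × Fin s) A ℂ) (x : EuclideanSpace ℂ A)
    (y : EuclideanSpace ℂ B) : EuclideanSpace ℂ (Fin s) :=
  WithLp.toLp 2 fun e => star y.ofLp ⬝ᵥ (basisKraus V e *ᵥ x.ofLp)

theorem envVec_sub_left (V : Matrix (B × Fin s) A ℂ) (x x' : EuclideanSpace ℂ A)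
    (y : EuclideanSpace ℂ B) : envVec V (x - x') y = envVec V x y - envVec V x' y := by
  ext e
  simp [envVec, Matrix.mulVec_sub]

theorem envVec_sub_right (V : Matrix (B × Fin s) A ℂ) (x : EuclideanSpace ℂ A)
    (y y' : EuclideanSpace ℂ B) : envVec V x (y - y') = envVec V x y - envVec V x y' := by
  ext e
  simp [envVec, sub_dotProduct]

theorem envVec_smul_smul (V : Matrix (B × Fin s) A ℂ) (c d : ℝ) (x : EuclideanSpace ℂ A)
    (y : EuclideanSpace ℂ B) :
    envVec V ((c : ℂ) • x) ((d : ℂ) • y) = ((c * d : ℝ) : ℂ) • envVec V x y := by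
  ext e
  simp [envVec, Matrix.mulVec_smul, mul_assoc]

/-- Cauchy–Schwarz in B for each environment index, then ‖Vx‖ = ‖x‖. -/
theorem norm_envVec_le [DecidableEq A] {V : Matrix (B × Fin s) A ℂ} (hV : Vᴴ * V = 1)
    (x : EuclideanSpace ℂ A) (y : EuclideanSpace ℂ B) : ‖envVec V x y‖ ≤ ‖x‖ * ‖y‖ := by
  refine abs_le_of_sq_le_sq' ?_ (by positivity) |>.2
  rw [EuclideanSpace.norm_sq_eq]
  have h1 : ∀ e, ‖envVec V x y e‖ ^ 2 ≤ ‖y‖ ^ 2 * ∑ b, ‖(V *ᵥ x.ofLp) (b, e)‖ ^ 2 := by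
    intro e
    have h := norm_inner_le_norm (𝕜 := ℂ) y (WithLp.toLp 2 (basisKraus V e *ᵥ x.ofLp))
    rw [EuclideanSpace.inner_eq_star_dotProduct, dotProduct_comm] at h
    have h' := pow_le_pow_left₀ (norm_nonneg _) h 2
    rw [mul_pow, EuclideanSpace.norm_sq_eq (WithLp.toLp 2 (basisKraus V e *ᵥ x.ofLp))] at h'
    exact h'
  refine (Finset.sum_le_sum fun e _ => h1 e).trans ?_
  have h2 : ∑ p, ‖(V *ᵥ x.ofLp) p‖ ^ 2 = ‖x‖ ^ 2 := by
    have e1 : star (V *ᵥ x.ofLp) ⬝ᵥ (V *ᵥ x.ofLp) = star x.ofLp ⬝ᵥ x.ofLp := by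
      rw [Matrix.star_mulVec, ← Matrix.dotProduct_mulVec, Matrix.mulVec_mulVec, hV,
        Matrix.one_mulVec]
    rw [EuclideanSpace.norm_sq_eq]
    rw [star_dotProduct_self_eq_sum, star_dotProduct_self_eq_sum] at e1
    exact_mod_cast e1
  rw [← Finset.mul_sum, Finset.sum_comm, ← Fintype.sum_prod_type'
    (f := fun b e => ‖(V *ᵥ x.ofLp) (b, e)‖ ^ 2), h2, mul_pow, mul_comm]

/-- The bridge to probability: the quadratic form of the sampled map is an empirical mean of squared
overlaps with one environment vector. -/
theorem sum_norm_sampledKraus {n : ℕ} (V : Matrix (B × Fin s) A ℂ)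
    (φ : Fin n → UnitSphere s) (x : EuclideanSpace ℂ A) (y : EuclideanSpace ℂ B) :
    ∑ i, ‖star y.ofLp ⬝ᵥ (sampledKraus V φ i *ᵥ x.ofLp)‖ ^ 2 =
      s / n * ∑ i, ‖inner ℂ (envVec V x y) (φ i).1‖ ^ 2 := by
  rw [Finset.mul_sum]
  refine Finset.sum_congr rfl fun i _ => ?_
  have h : star y.ofLp ⬝ᵥ (envKraus V (φ i) *ᵥ x.ofLp) = inner ℂ (φ i).1 (envVec V x y) := by
    simp only [envKraus, Matrix.sum_mulVec, dotProduct_sum, Matrix.smul_mulVec, dotProduct_smul,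
      EuclideanSpace.inner_eq_star_dotProduct]
    rw [dotProduct_comm]
    rfl
  rw [sampledKraus, Matrix.smul_mulVec, dotProduct_smul, h, smul_eq_mul, norm_mul,
    norm_inner_symm, mul_pow, Complex.norm_real, Real.norm_eq_abs, sq_abs,
    Real.sq_sqrt (by positivity)]

end Stinespring

/-! ### Grids in complex balls -/

section Net

/-- A grid in the unit ball of `ℂ^ι`. -/
theorem exists_finset_net (ι : Type*) [Fintype ι] {m : ℕ} (hm : 0 < m) :
    ∃ S : Finset (EuclideanSpace ℂ ι), S.card ≤ ((2 * m + 1) ^ 2) ^ Fintype.card ι ∧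
      ∀ x : EuclideanSpace ℂ ι, ‖x‖ ≤ 1 →
        ∃ z ∈ S, ‖x - z‖ ≤ 2 * Fintype.card ι / m := by
  classical
  have hm' : (0 : ℝ) < m := Nat.cast_pos.2 hm
  let I : Finset (ℤ × ℤ) := Finset.Icc (-(m : ℤ)) m ×ˢ Finset.Icc (-(m : ℤ)) m
  let g : (ι → ℤ × ℤ) → EuclideanSpace ℂ ι := fun k =>
    WithLp.toLp 2 fun i => (⟨(k i).1 / m, (k i).2 / m⟩ : ℂ)
  have hfl : ∀ t : ℝ, |t| ≤ 1 → ⌊m * t⌋ ∈ Finset.Icc (-(m : ℤ)) m := by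
    intro t ht
    obtain ⟨h1, h2⟩ := abs_le.1 ht
    rw [Finset.mem_Icc]
    constructor
    · rw [Int.le_floor]; push_cast; nlinarith
    · have := Int.floor_le (m * t)
      have h3 : ((⌊m * t⌋ : ℤ) : ℝ) ≤ (m : ℤ) := by push_cast; nlinarith
      exact_mod_cast h3
  have hap : ∀ t : ℝ, |t - ⌊m * t⌋ / m| ≤ 1 / m := by
    intro t
    have h1 := Int.floor_le (m * t)
    have h2 := Int.lt_floor_add_one (m * t)
    rw [show t - ⌊m * t⌋ / m = (m * t - ⌊m * t⌋) / m by field_simp, abs_div, abs_of_pos hm',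
      abs_of_nonneg (by linarith)]
    gcongr
    linarith
  refine ⟨(Fintype.piFinset fun _ : ι => I).image g, ?_, fun x hx => ?_⟩
  · refine Finset.card_image_le.trans (le_of_eq ?_)
    rw [Fintype.card_piFinset, Finset.prod_const, Finset.card_product, Int.card_Icc, sq]
    congr 2 <;> omega
  · have hxi : ∀ i, ‖x i‖ ≤ 1 := fun i => (PiLp.norm_apply_le x i).trans hx
    refine ⟨g fun i => (⌊m * (x i).re⌋, ⌊m * (x i).im⌋), Finset.mem_image_of_mem _ ?_, ?_⟩
    · rw [Fintype.mem_piFinset]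
      intro i
      exact Finset.mem_product.2 ⟨hfl _ ((Complex.abs_re_le_norm _).trans (hxi i)),
        hfl _ ((Complex.abs_im_le_norm _).trans (hxi i))⟩
    · refine abs_le_of_sq_le_sq' ?_ (by positivity) |>.2
      rw [EuclideanSpace.norm_sq_eq]
      have h : ∀ i, ‖(x - g fun i => (⌊m * (x i).re⌋, ⌊m * (x i).im⌋)) i‖ ^ 2 ≤ (2 / m) ^ 2 := by
        intro i
        refine pow_le_pow_left₀ (norm_nonneg _) ?_ 2
        refine (Complex.norm_le_abs_re_add_abs_im _).trans ?_
        have h1 := hap (x i).re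
        have h2 := hap (x i).im
        simp only [g, PiLp.sub_apply, Complex.sub_re, Complex.sub_im]
        calc _ ≤ (1 / m + 1 / m : ℝ) := add_le_add h1 h2
          _ = 2 / m := by ring
      refine (Finset.sum_le_sum fun i _ => h i).trans ?_
      -- The sharp factor √d is relaxed to d; the mesh affects the final bound only through a
      -- logarithm.
      rw [Finset.sum_const, Finset.card_univ, nsmul_eq_mul,
        show (2 * (Fintype.card ι : ℝ) / m) ^ 2 = Fintype.card ι ^ 2 * (2 / m) ^ 2 by ring]
      gcongr
      exact_mod_cast Nat.le_self_pow two_ne_zero _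

end Net

/-! ### Deviation from the mean and its continuity -/

section Deviation

variable {s n : ℕ}

/-- The deviation of the empirical squared overlap of `v` from its mean. -/
noncomputable def deviation (φ : Fin n → UnitSphere s) (v : EuclideanSpace ℂ (Fin s)) : ℝ :=
  s / n * ∑ i, ‖inner ℂ v (φ i).1‖ ^ 2 - ‖v‖ ^ 2

theorem deviation_smul (φ : Fin n → UnitSphere s) (c : ℝ) (v : EuclideanSpace ℂ (Fin s)) :
    deviation φ ((c : ℂ) • v) = c ^ 2 * deviation φ v := by
  simp only [deviation, inner_smul_left, norm_mul, norm_smul, mul_pow, ← Finset.mul_sum]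
  simp
  ring

theorem abs_sq_sub_sq_le_of_norm {E : Type*} [SeminormedAddCommGroup E] (v w : E) :
    |‖v‖ ^ 2 - ‖w‖ ^ 2| ≤ ‖v - w‖ * (‖v‖ + ‖w‖) := by
  rw [sq_sub_sq, abs_mul, abs_of_nonneg (by positivity : 0 ≤ ‖v‖ + ‖w‖), mul_comm]
  gcongr
  exact abs_norm_sub_norm_le v w

/-- A deterministic bound, valid for every sample: each overlap is at most the norm, so the
empirical term contributes s and the mean contributes 1. -/
theorem abs_deviation_sub_le (hn : 0 < n) (φ : Fin n → UnitSphere s)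
    (v w : EuclideanSpace ℂ (Fin s)) :
    |deviation φ v - deviation φ w| ≤ (s + 1) * (‖v - w‖ * (‖v‖ + ‖w‖)) := by
  have hn' : (0 : ℝ) < n := Nat.cast_pos.2 hn
  have h1 : |∑ i, ‖inner ℂ v (φ i).1‖ ^ 2 - ∑ i, ‖inner ℂ w (φ i).1‖ ^ 2| ≤
      n * (‖v - w‖ * (‖v‖ + ‖w‖)) := by
    rw [← Finset.sum_sub_distrib]
    refine (Finset.abs_sum_le_sum_abs _ _).trans ?_
    have : ∀ i ∈ Finset.univ, |‖inner ℂ v (φ i).1‖ ^ 2 - ‖inner ℂ w (φ i).1‖ ^ 2| ≤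
        ‖v - w‖ * (‖v‖ + ‖w‖) := by
      intro i _
      have hb : ∀ z : EuclideanSpace ℂ (Fin s), ‖inner ℂ z (φ i).1‖ ≤ ‖z‖ := by
        intro z
        simpa [norm_eq_of_mem_sphere] using norm_inner_le_norm (𝕜 := ℂ) z (φ i).1
      refine (abs_sq_sub_sq_le_of_norm _ _).trans ?_
      rw [← inner_sub_left]
      gcongr <;> apply hb
    refine (Finset.sum_le_sum this).trans ?_
    simp
  have h2 := abs_sq_sub_sq_le_of_norm v w
  have h3 : deviation φ v - deviation φ w =
      s / n * (∑ i, ‖inner ℂ v (φ i).1‖ ^ 2 - ∑ i, ‖inner ℂ w (φ i).1‖ ^ 2) -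
        (‖v‖ ^ 2 - ‖w‖ ^ 2) := by
    simp only [deviation]; ring
  rw [h3]
  refine (abs_sub _ _).trans ?_
  rw [abs_mul, abs_of_nonneg (by positivity : (0 : ℝ) ≤ s / n)]
  calc _ ≤ s / n * (n * (‖v - w‖ * (‖v‖ + ‖w‖))) + ‖v - w‖ * (‖v‖ + ‖w‖) := by gcongr
    _ = _ := by field_simp

end Deviation

end ChannelCompression

namespace ChannelCompression

open Matrix

/-! ### From the grid to all vectors, and the union bound -/

section Sampling

variable {A B : Type*} [Fintype A] [Fintype B] {s n : ℕ}

/-- A relative bound on the deviation at net points extends to all vectors, up to a small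
additive error. -/
theorem abs_deviation_envVec_le_of_net [DecidableEq A] [Nonempty B]
    {V : Matrix (B × Fin s) A ℂ}
    (hV : Vᴴ * V = 1) (hs : 2 ≤ s) (hn : 0 < n) (hA : Fintype.card A ≤ s) (hB : Fintype.card B ≤ s)
    {ε : ℝ} (hε : 0 < ε) (hε1 : ε < 1) {m : ℕ} (hm : 60 * s ^ 3 / ε ≤ m)
    {S : Finset (EuclideanSpace ℂ A)} {T : Finset (EuclideanSpace ℂ B)}
    (hS : ∀ x : EuclideanSpace ℂ A, ‖x‖ ≤ 1 → ∃ z ∈ S, ‖x - z‖ ≤ 2 * Fintype.card A / m)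
    (hT : ∀ y : EuclideanSpace ℂ B, ‖y‖ ≤ 1 → ∃ z ∈ T, ‖y - z‖ ≤ 2 * Fintype.card B / m)
    {φ : Fin n → UnitSphere s}
    (hφ : ∀ x ∈ S, ∀ y ∈ T, |deviation φ (envVec V x y)| ≤ ε * ‖envVec V x y‖ ^ 2)
    (x : EuclideanSpace ℂ A) (y : EuclideanSpace ℂ B) :
    |deviation φ (envVec V x y)| ≤
      ε * (‖envVec V x y‖ ^ 2 + (Fintype.card B : ℝ)⁻¹ * (‖x‖ ^ 2 * ‖y‖ ^ 2)) := by
  have hs' : (2 : ℝ) ≤ s := by exact_mod_cast hs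
  have hs0 : (0 : ℝ) < s := by linarith
  have hA' : (Fintype.card A : ℝ) ≤ s := by exact_mod_cast hA
  have hB' : (Fintype.card B : ℝ) ≤ s := by exact_mod_cast hB
  have hB0 : (0 : ℝ) < Fintype.card B := by exact_mod_cast Fintype.card_pos
  have hm0 : (0 : ℝ) < m := lt_of_lt_of_le (by positivity) hm
  -- δ bounds both grid errors since |A|, |B| ≤ s, and m ≥ 60s³/ε is exactly what gives 30s²δ ≤ ε.
  set δ : ℝ := 2 * s / m with hδ
  have hδ0 : 0 < δ := by positivity
  have hδs : 30 * s ^ 2 * δ ≤ ε := by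
    rw [hδ, mul_div_assoc', div_le_iff₀ hm0]
    rw [div_le_iff₀ hε] at hm
    nlinarith
  have hδ1 : δ ≤ 1 := by nlinarith
  have unit_case : ∀ (x : EuclideanSpace ℂ A) (y : EuclideanSpace ℂ B), ‖x‖ ≤ 1 → ‖y‖ ≤ 1 →
      |deviation φ (envVec V x y)| ≤
        ε * (‖envVec V x y‖ ^ 2 + (Fintype.card B : ℝ)⁻¹) := by
    intro x y hx hy
    obtain ⟨z, hz, hxz⟩ := hS x hx
    obtain ⟨w, hw, hyw⟩ := hT y hy
    have hxz' : ‖x - z‖ ≤ δ := hxz.trans (by rw [hδ]; gcongr)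
    have hyw' : ‖y - w‖ ≤ δ := hyw.trans (by rw [hδ]; gcongr)
    have hz2 : ‖z‖ ≤ 2 := by
      have := norm_sub_norm_le z x
      rw [norm_sub_rev] at this
      linarith
    have hw2 : ‖w‖ ≤ 2 := by
      have := norm_sub_norm_le w y
      rw [norm_sub_rev] at this
      linarith
    have hv1 : ‖envVec V x y‖ ≤ 1 :=
      (norm_envVec_le hV x y).trans (mul_le_one₀ hx (norm_nonneg _) hy)
    have hv2 : ‖envVec V z w‖ ≤ 4 := by
      refine (norm_envVec_le hV z w).trans ?_
      nlinarith [norm_nonneg z, norm_nonneg w]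
    have hd : ‖envVec V x y - envVec V z w‖ ≤ 3 * δ := by
      have e : envVec V x y - envVec V z w = envVec V (x - z) y + envVec V z (y - w) := by
        rw [envVec_sub_left, envVec_sub_right]; abel
      rw [e]
      refine (norm_add_le _ _).trans ((add_le_add (norm_envVec_le hV _ _)
        (norm_envVec_le hV _ _)).trans ?_)
      nlinarith [norm_nonneg z, norm_nonneg y, norm_nonneg (x - z), norm_nonneg (y - w)]
    have hprod : ‖envVec V x y - envVec V z w‖ * (‖envVec V x y‖ + ‖envVec V z w‖) ≤ 15 * δ := by
      calc _ ≤ 3 * δ * (1 + 4) := by gcongr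
        _ = _ := by ring
    have h1 := (abs_deviation_sub_le hn φ (envVec V x y) (envVec V z w)).trans
      (mul_le_mul_of_nonneg_left hprod (by positivity))
    have h2 := (abs_le.1 ((abs_sq_sub_sq_le_of_norm (envVec V x y) (envVec V z w)).trans hprod)).1
    have h3 := hφ z hz w hw
    have h4 : |deviation φ (envVec V x y)| ≤ |deviation φ (envVec V z w)| +
        |deviation φ (envVec V x y) - deviation φ (envVec V z w)| := by
      have := abs_add_le (deviation φ (envVec V z w))
        (deviation φ (envVec V x y) - deviation φ (envVec V z w))
      rwa [add_sub_cancel] at this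
    have h5 : ε * ‖envVec V z w‖ ^ 2 ≤ ε * ‖envVec V x y‖ ^ 2 + 15 * δ := by
      nlinarith
    -- The total additive loss is 15(s + 1)δ + 15δ, at most 30sδ because s ≥ 2; it fits under ε/|B|
    -- because |B| ≤ s.
    have h6 : 30 * s * δ ≤ ε * (Fintype.card B : ℝ)⁻¹ := by
      rw [← div_eq_mul_inv, le_div_iff₀ hB0]
      calc 30 * s * δ * Fintype.card B ≤ 30 * s * δ * s := by gcongr
        _ ≤ ε := by linarith
    nlinarith
  rcases eq_or_ne x 0 with rfl | hx
  · have : envVec V 0 y = 0 := by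
      rw [← norm_le_zero_iff]; simpa using norm_envVec_le hV 0 y
    simp [this, deviation]
  rcases eq_or_ne y 0 with rfl | hy
  · have : envVec V x 0 = 0 := by
      rw [← norm_le_zero_iff]; simpa using norm_envVec_le hV x 0
    simp [this, deviation]
  have hx0 : 0 < ‖x‖ := norm_pos_iff.2 hx
  have hy0 : 0 < ‖y‖ := norm_pos_iff.2 hy
  -- Both sides are homogeneous of degree two in x and in y, so normalising suffices.
  have h := unit_case (((‖x‖⁻¹ : ℝ) : ℂ) • x) (((‖y‖⁻¹ : ℝ) : ℂ) • y)
    (by simp [norm_smul, hx0.ne']) (by simp [norm_smul, hy0.ne'])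
  rw [envVec_smul_smul, deviation_smul, abs_mul, abs_of_nonneg (sq_nonneg _), norm_smul,
    mul_pow ‖_‖ ‖envVec V x y‖, Complex.norm_real, Real.norm_eq_abs, sq_abs] at h
  have h' := mul_le_mul_of_nonneg_left h (by positivity : 0 ≤ (‖x‖ * ‖y‖) ^ 2)
  have e : (‖x‖ * ‖y‖) ^ 2 * (‖x‖⁻¹ * ‖y‖⁻¹) ^ 2 = 1 := by field_simp
  calc |deviation φ (envVec V x y)|
      = (‖x‖ * ‖y‖) ^ 2 * ((‖x‖⁻¹ * ‖y‖⁻¹) ^ 2 * |deviation φ (envVec V x y)|) := by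
        rw [← mul_assoc, e, one_mul]
    _ ≤ _ := h'
    _ = ε * (((‖x‖ * ‖y‖) ^ 2 * (‖x‖⁻¹ * ‖y‖⁻¹) ^ 2) * ‖envVec V x y‖ ^ 2 +
        (Fintype.card B : ℝ)⁻¹ * (‖x‖ ^ 2 * ‖y‖ ^ 2)) := by ring
    _ = _ := by rw [e, one_mul]

/-- Union bound over finitely many environment vectors. -/
theorem le_iidUniform_deviation_le (hs : 0 < s) (hn : 0 < n)
    (T : Finset (EuclideanSpace ℂ (Fin s))) {ε : ℝ} (hε : 0 < ε) (hε1 : ε ≤ 1) :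
    1 - T.card * (2 * Real.exp (-(n * ε ^ 2 / 4))) ≤
      (iidUniform s n).real {φ | ∀ v ∈ T, |deviation φ v| ≤ ε * ‖v‖ ^ 2} := by
  have := isProbabilityMeasure_uniformSphere hs
  have : MeasureTheory.IsProbabilityMeasure (iidUniform s n) := by
    unfold iidUniform; infer_instance
  have hn' : (0 : ℝ) < n := Nat.cast_pos.2 hn
  set bad : EuclideanSpace ℂ (Fin s) → Set (Fin n → UnitSphere s) := fun v =>
    {φ | n * (ε * ‖v‖ ^ 2) < |∑ i, (s * ‖inner ℂ v (φ i).1‖ ^ 2 - ‖v‖ ^ 2)|} with hbad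
  have hdev : ∀ (φ : Fin n → UnitSphere s) v,
      ∑ i, (s * ‖inner ℂ v (φ i).1‖ ^ 2 - ‖v‖ ^ 2) = n * deviation φ v := by
    intro φ v
    rw [Finset.sum_sub_distrib, ← Finset.mul_sum, deviation]
    simp
    field_simp
  -- Covering the whole space and using subadditivity needs no measurability of the good event.
  have hcover : (Set.univ : Set (Fin n → UnitSphere s)) ⊆
      {φ | ∀ v ∈ T, |deviation φ v| ≤ ε * ‖v‖ ^ 2} ∪ ⋃ v ∈ T, bad v := by
    intro φ _
    by_cases h : ∀ v ∈ T, |deviation φ v| ≤ ε * ‖v‖ ^ 2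
    · exact Or.inl h
    · push Not at h
      obtain ⟨v, hv, hlt⟩ := h
      refine Or.inr (Set.mem_biUnion hv ?_)
      simp only [hbad, Set.mem_ofPred_eq, hdev, abs_mul, abs_of_pos hn']
      gcongr
  have h1 := MeasureTheory.measureReal_mono (μ := iidUniform s n) hcover
  rw [MeasureTheory.probReal_univ] at h1
  have h2 := h1.trans (MeasureTheory.measureReal_union_le _ _)
  have h3 := MeasureTheory.measureReal_biUnion_finset_le (μ := iidUniform s n) T bad
  have h4 : ∑ v ∈ T, (iidUniform s n).real (bad v) ≤
      T.card * (2 * Real.exp (-(n * ε ^ 2 / 4))) := by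
    rw [← nsmul_eq_mul]
    exact Finset.sum_le_card_nsmul _ _ _ fun v _ => iidUniform_deviation_le hs n v hε hε1
  linarith

/-- In a one-dimensional environment every overlap equals ‖v‖². This case is separate because
log(1/ε) can be arbitrarily small, which defeats the union bound. -/
theorem deviation_eq_zero_of_one (hn : 0 < n) (φ : Fin n → UnitSphere 1)
    (v : EuclideanSpace ℂ (Fin 1)) : deviation φ v = 0 := by
  have hn' : (n : ℝ) ≠ 0 := (Nat.cast_pos.2 hn).ne'
  have h : ∀ i, ‖inner ℂ v (φ i).1‖ ^ 2 = ‖v‖ ^ 2 := by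
    intro i
    have h1 : ‖(φ i).1‖ ^ 2 = 1 := by rw [norm_eq_of_mem_sphere, one_pow]
    rw [EuclideanSpace.norm_sq_eq, Fin.sum_univ_one] at h1
    rw [EuclideanSpace.norm_sq_eq, PiLp.inner_apply, Fin.sum_univ_one, Fin.sum_univ_one,
      RCLike.inner_apply, norm_mul, mul_pow, h1, one_mul, RCLike.norm_conj]
  simp [deviation, h, hn']

/-- A grid fine enough for accuracy `ε / s ^ 3` has `exp (O (d log (s / ε)))` points. -/
theorem card_net_le {s : ℕ} (hs : 2 ≤ s) {ε : ℝ} (hε : 0 < ε) (hε1 : ε < 1) (d : ℕ) :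
    (((2 * ⌈60 * (s : ℝ) ^ 3 / ε⌉₊ + 1) ^ 2) ^ d : ℝ) ≤ Real.exp (22 * (d * Real.log (s / ε))) := by
  have hs' : (2 : ℝ) ≤ s := by exact_mod_cast hs
  set r : ℝ := s / ε with hr
  have hsr : s ≤ r := by rw [hr, le_div_iff₀ hε]; nlinarith
  have hr2 : 2 ≤ r := hs'.trans hsr
  have hr0 : 0 < r := by linarith
  have hr3 : (s : ℝ) ^ 3 / ε ≤ r ^ 3 := by
    calc (s : ℝ) ^ 3 / ε = s ^ 2 * r := by rw [hr]; ring
      _ ≤ r ^ 2 * r := by gcongr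
      _ = r ^ 3 := by ring
  have hr31 : 8 ≤ r ^ 3 := by
    calc (8 : ℝ) = 2 ^ 3 := by norm_num
      _ ≤ r ^ 3 := by gcongr
  have hm : (⌈60 * (s : ℝ) ^ 3 / ε⌉₊ : ℝ) ≤ 60 * r ^ 3 + 1 := by
    refine (Nat.ceil_lt_add_one (by positivity)).le.trans ?_
    rw [mul_div_assoc]
    linarith
  have h8 : (256 : ℝ) ≤ r ^ 8 := by
    calc (256 : ℝ) = 2 ^ 8 := by norm_num
      _ ≤ r ^ 8 := by gcongr
  -- The base is at most 120r³ + 3 ≤ 256r³, and 256 = 2⁸ ≤ r⁸; squaring r¹¹ gives the constant 22.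
  have hbase : (2 * ⌈60 * (s : ℝ) ^ 3 / ε⌉₊ + 1 : ℝ) ≤ r ^ 11 := by
    calc (2 * ⌈60 * (s : ℝ) ^ 3 / ε⌉₊ + 1 : ℝ) ≤ 256 * r ^ 3 := by linarith
      _ ≤ r ^ 8 * r ^ 3 := by gcongr
      _ = r ^ 11 := by ring
  calc (((2 * ⌈60 * (s : ℝ) ^ 3 / ε⌉₊ + 1) ^ 2) ^ d : ℝ) ≤ ((r ^ 11) ^ 2) ^ d := by gcongr
    _ = r ^ (22 * d) := by ring
    _ = Real.exp (22 * (d * Real.log r)) := by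
      rw [← Real.exp_log (pow_pos hr0 (22 * d)), Real.log_pow]; push_cast; ring_nf

theorem sandwich_sampledMap [DecidableEq B] {N : Matrix A A ℂ →ₗ[ℂ] Matrix B B ℂ}
    {V : Matrix (B × Fin s) A ℂ} (hN : ∀ X, N X = partialTrace (V * X * Vᴴ)) {ε : ℝ}
    {φ : Fin n → UnitSphere s}
    (h : ∀ (x : EuclideanSpace ℂ A) (y : EuclideanSpace ℂ B), |deviation φ (envVec V x y)| ≤
      ε * (‖envVec V x y‖ ^ 2 + (Fintype.card B : ℝ)⁻¹ * (‖x‖ ^ 2 * ‖y‖ ^ 2))) :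
    Sandwich N (sampledMap V φ) ε := by
  refine sandwich_of_forall (basisKraus V) (sampledKraus V φ)
    (fun X => by rw [hN, partialTrace_eq_sum_basisKraus]) (sampledMap_apply V φ) fun x y => ?_
  have h1 := h (WithLp.toLp 2 x) (WithLp.toLp 2 y)
  have h2 := sum_norm_sampledKraus V φ (WithLp.toLp 2 x) (WithLp.toLp 2 y)
  have h3 : ‖envVec V (WithLp.toLp 2 x) (WithLp.toLp 2 y)‖ ^ 2 =
    ∑ e, ‖star y ⬝ᵥ (basisKraus V e *ᵥ x)‖ ^ 2 := EuclideanSpace.norm_sq_eq _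
  rw [deviation, ← h2, h3, EuclideanSpace.norm_sq_eq, EuclideanSpace.norm_sq_eq] at h1
  exact h1

/-- Random sampling of environment vectors compresses the channel with probability `≥ 1/2`. -/
theorem half_le_iidUniform_sandwich [DecidableEq A] [DecidableEq B] [Nonempty A] [Nonempty B]
    {N : Matrix A A ℂ →ₗ[ℂ] Matrix B B ℂ} {V : Matrix (B × Fin s) A ℂ} (hV : IsStinespring V N)
    (hA : Fintype.card A ≤ s) (hB : Fintype.card B ≤ s) {ε : ℝ} (hε : 0 < ε) (hε1 : ε < 1)
    (hn : 200 * max (Fintype.card A : ℝ) (Fintype.card B : ℝ) * Real.log (s / ε) / ε ^ 2 ≤ n) :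
    1 / 2 ≤ iidUniform s n {φ | Sandwich N (sampledMap V φ) ε} := by
  have hA0 : 0 < Fintype.card A := Fintype.card_pos
  have hs : 0 < s := hA0.trans_le hA
  have := isProbabilityMeasure_uniformSphere hs
  have : MeasureTheory.IsProbabilityMeasure (iidUniform s n) := by
    unfold iidUniform; infer_instance
  set D : ℝ := max (Fintype.card A : ℝ) (Fintype.card B : ℝ) with hD
  have hD1 : 1 ≤ D := le_max_of_le_left (by exact_mod_cast hA0)
  have hs1 : (1 : ℝ) ≤ s := by exact_mod_cast hs
  have hlog : 0 < Real.log (s / ε) := Real.log_pos (by rw [lt_div_iff₀ hε]; linarith)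
  have hn0 : 0 < n := by
    have : (0 : ℝ) < n := lt_of_lt_of_le (by positivity) hn
    exact_mod_cast this
  rcases Nat.lt_or_ge s 2 with h1 | h2
  · obtain rfl : s = 1 := by omega
    have : {φ : Fin n → UnitSphere 1 | Sandwich N (sampledMap V φ) ε} = Set.univ := by
      refine Set.eq_univ_of_forall fun φ => sandwich_sampledMap hV.2 fun x y => ?_
      rw [deviation_eq_zero_of_one hn0, abs_zero]
      positivity
    rw [this, MeasureTheory.measure_univ]
    exact ENNReal.div_le_of_le_mul (by norm_num)
  classical
  have hs2 : (2 : ℝ) ≤ s := by exact_mod_cast h2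
  set m : ℕ := ⌈60 * (s : ℝ) ^ 3 / ε⌉₊ with hm
  have hm0 : 0 < m := Nat.ceil_pos.2 (by positivity)
  obtain ⟨S, hScard, hS⟩ := exists_finset_net A hm0
  obtain ⟨T, hTcard, hT⟩ := exists_finset_net B hm0
  set W : Finset (EuclideanSpace ℂ (Fin s)) := Finset.image₂ (envVec V) S T
  have hprob := le_iidUniform_deviation_le hs hn0 W hε hε1.le
  have hL2 : Real.log 2 ≤ Real.log (s / ε) :=
    Real.log_le_log (by norm_num) (by rw [le_div_iff₀ hε]; nlinarith)
  have hWcard : (W.card : ℝ) ≤ Real.exp (44 * (D * Real.log (s / ε))) := by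
    have e1 : (S.card : ℝ) ≤ Real.exp (22 * (Fintype.card A * Real.log (s / ε))) :=
      le_trans (by rw [← hm]; exact_mod_cast hScard) (card_net_le h2 hε hε1 _)
    have e2 : (T.card : ℝ) ≤ Real.exp (22 * (Fintype.card B * Real.log (s / ε))) :=
      le_trans (by rw [← hm]; exact_mod_cast hTcard) (card_net_le h2 hε hε1 _)
    calc (W.card : ℝ) ≤ S.card * T.card := by
          exact_mod_cast Finset.card_image₂_le (envVec V) S T
      _ ≤ Real.exp (22 * (D * Real.log (s / ε))) * Real.exp (22 * (D * Real.log (s / ε))) := by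
        gcongr
        · refine e1.trans ?_
          gcongr
          exact le_max_left _ _
        · refine e2.trans ?_
          gcongr
          exact le_max_right _ _
      _ = _ := by rw [← Real.exp_add]; ring_nf
  -- The two grids contribute 44 = 22 + 22 and the tail 50 = 200/4. The surplus 6 D log(s/ε) ≥ 2 log
  -- 2 turns the prefactor 2 into 1/2.
  have hsmall : (W.card : ℝ) * (2 * Real.exp (-(n * ε ^ 2 / 4))) ≤ 1 / 2 := by
    rw [div_le_iff₀ (by positivity)] at hn
    calc (W.card : ℝ) * (2 * Real.exp (-(n * ε ^ 2 / 4)))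
        ≤ Real.exp (44 * (D * Real.log (s / ε))) *
          (2 * Real.exp (-(50 * (D * Real.log (s / ε))))) := by
          gcongr
          linarith
      _ = 2 * Real.exp (-(6 * (D * Real.log (s / ε)))) := by
          rw [mul_left_comm, ← Real.exp_add]; ring_nf
      _ ≤ 2 * Real.exp (-(2 * Real.log 2)) := by
          have := Real.log_pos one_lt_two
          gcongr
          · norm_num
          · nlinarith
      _ = 1 / 2 := by
          rw [← neg_mul, mul_comm (-2), Real.exp_mul, Real.exp_log two_pos]
          norm_num
  have hsub : {φ : Fin n → UnitSphere s | ∀ v ∈ W, |deviation φ v| ≤ ε * ‖v‖ ^ 2} ⊆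
      {φ | Sandwich N (sampledMap V φ) ε} := by
    intro φ hφ
    refine sandwich_sampledMap hV.2 fun x y => ?_
    exact abs_deviation_envVec_le_of_net hV.1 h2 hn0 hA hB hε hε1 (Nat.le_ceil _) hS hT
      (fun x hx y hy => hφ _ (Finset.mem_image₂_of_mem hx hy)) x y
  have hreal : 1 / 2 ≤ (iidUniform s n).real {φ | Sandwich N (sampledMap V φ) ε} :=
    le_trans (by linarith) (MeasureTheory.measureReal_mono hsub)
  rw [← MeasureTheory.ofReal_measureReal]
  refine le_trans (le_of_eq ?_) (ENNReal.ofReal_le_ofReal hreal)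
  rw [ENNReal.ofReal_div_of_pos two_pos]
  simp

end Sampling

end ChannelCompression

namespace ChannelCompression

open Matrix

/-! ### Trace-norm bounds and trace-preserving correction -/

section Consequences

variable {A B : Type*} [Fintype A] [Fintype B]

theorem trace_sandwich_bound [DecidableEq B] [Nonempty B] {N : Matrix A A ℂ →ₗ[ℂ] Matrix B B ℂ}
    (hTP : IsTP N) {ρ : Matrix A A ℂ} (hρ : ρ.trace = 1) (ε : ℝ) :
    (ε • (N ρ + (Fintype.card B : ℝ)⁻¹ • (1 : Matrix B B ℂ))).trace = ((2 * ε : ℝ) : ℂ) := by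
  have hB : (Fintype.card B : ℂ) ≠ 0 := by exact_mod_cast Fintype.card_ne_zero
  rw [Matrix.trace_smul, Matrix.trace_add, Matrix.trace_smul, Matrix.trace_one, hTP, hρ]
  simp only [Complex.real_smul]
  push_cast
  rw [inv_mul_cancel₀ hB]
  ring

theorem Sandwich.traceNorm_le [DecidableEq B] [Nonempty B]
    {N M : Matrix A A ℂ →ₗ[ℂ] Matrix B B ℂ} (hTP : IsTP N) {ε : ℝ} (h : Sandwich N M ε)
    {ρ : Matrix A A ℂ} (hρ : IsState ρ) : traceNorm (M ρ - N ρ) ≤ 2 * ε := by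
  have h1 := traceNorm_le_trace (h ρ hρ).1 (h ρ hρ).2
  rwa [trace_sandwich_bound hTP hρ.2, Complex.ofReal_re] at h1

/-- The adjoint of a Kraus map, evaluated at the identity, computes traces. -/
theorem HasKraus.exists_trace_eq {N : Matrix A A ℂ →ₗ[ℂ] Matrix B B ℂ} {n : ℕ}
    (h : HasKraus N n) : ∃ S : Matrix A A ℂ, S.IsHermitian ∧ ∀ X, (N X).trace = (S * X).trace := by
  obtain ⟨K, hK⟩ := h
  refine ⟨∑ i, (K i)ᴴ * K i, ?_, fun X => ?_⟩
  · rw [Matrix.IsHermitian, conjTranspose_sum]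
    simp
  · rw [hK, Matrix.trace_sum, Finset.sum_mul, Matrix.trace_sum]
    refine Finset.sum_congr rfl fun i _ => ?_
    rw [Matrix.trace_mul_comm, Matrix.mul_assoc]

/-- Positivity can be tested on states. -/
theorem posSemidef_of_forall_isState {G : Matrix A A ℂ} (hG : G.IsHermitian)
    (h : ∀ ρ, IsState ρ → 0 ≤ (G * ρ).trace) : G.PosSemidef := by
  refine .of_dotProduct_mulVec_nonneg hG fun x => ?_
  have htr : star x ⬝ᵥ (G *ᵥ x) = (G * vecMulVec x (star x)).trace := by
    rw [Matrix.mul_vecMulVec, Matrix.trace_vecMulVec, dotProduct_comm]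
  rcases eq_or_ne x 0 with rfl | hx
  · simp
  set t : ℝ := ∑ a, ‖x a‖ ^ 2 with ht
  have ht0 : 0 < t := by
    obtain ⟨a, ha⟩ := Function.ne_iff.1 hx
    exact Finset.sum_pos' (fun _ _ => by positivity)
      ⟨a, Finset.mem_univ a, by have := norm_pos_iff.2 ha; positivity⟩
  have hρ : IsState ((t⁻¹ : ℝ) • vecMulVec x (star x)) := by
    refine ⟨(Matrix.posSemidef_vecMulVec_self_star x).smul (inv_nonneg.2 ht0.le), ?_⟩
    rw [Matrix.trace_smul, Matrix.trace_vecMulVec, dotProduct_comm, star_dotProduct_self_eq_sum,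
      ← ht, Complex.real_smul, ← Complex.ofReal_mul, inv_mul_cancel₀ ht0.ne', Complex.ofReal_one]
  have h1 := h _ hρ
  rw [Matrix.mul_smul, Matrix.trace_smul, ← htr] at h1
  have h2 := smul_nonneg ht0.le h1
  rwa [smul_smul, mul_inv_cancel₀ ht0.ne', one_smul] at h2

/-- Measuring a positive operator `G` and preparing a fixed basis state. -/
noncomputable def measurePrepare [DecidableEq B] (G : Matrix A A ℂ) (b : B) :
    Matrix A A ℂ →ₗ[ℂ] Matrix B B ℂ :=
  (LinearMap.toSpanSingleton ℂ (Matrix B B ℂ) (Matrix.single b b 1)) ∘ₗ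
    (Matrix.traceLinearMap A ℂ ℂ) ∘ₗ (LinearMap.mulLeft ℂ G)

omit [Fintype B] in
theorem measurePrepare_apply [DecidableEq B] (G : Matrix A A ℂ) (b : B) (X : Matrix A A ℂ) :
    measurePrepare G b X = (G * X).trace • Matrix.single b b 1 := rfl

omit [Fintype B] in
-- Writing G = L†L, each row of L gives one rank-one Kraus operator with output b, hence |A| in all.
theorem hasKraus_measurePrepare [DecidableEq A] [DecidableEq B] {G : Matrix A A ℂ}
    (hG : G.PosSemidef) (b : B) : HasKraus (measurePrepare G b) (Fintype.card A) := by
  obtain ⟨L, hL⟩ := CStarAlgebra.nonneg_iff_eq_star_mul_self.1 hG.nonneg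
  have key : ∀ X, measurePrepare G b X =
      ∑ a, vecMulVec (Pi.single b 1) (L a) * X * (vecMulVec (Pi.single b 1) (L a))ᴴ := by
    intro X
    have h1 : (G * X).trace = ∑ a, (L * X * Lᴴ) a a := by
      rw [hL, Matrix.mul_assoc, Matrix.trace_mul_comm]; rfl
    rw [measurePrepare_apply, h1, Finset.sum_smul]
    refine Finset.sum_congr rfl fun a _ => ?_
    ext i j
    simp [Matrix.mul_apply, Matrix.vecMulVec_apply, Matrix.single_apply, Pi.single_apply,
      Finset.sum_mul]
    rcases eq_or_ne i b with rfl | hi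
    · rcases eq_or_ne j i with rfl | hj
      · simp
      · simp [hj, hj.symm]
    · simp [hi, hi.symm]
  refine ⟨fun i => vecMulVec (Pi.single b 1) (L ((Fintype.equivFin A).symm i)), fun X => ?_⟩
  rw [key]
  exact ((Fintype.equivFin A).symm.sum_comp fun a =>
    vecMulVec (Pi.single b 1) (L a) * X * (vecMulVec (Pi.single b 1) (L a))ᴴ).symm

/-- An approximation in the sandwich sense can be made trace preserving at the cost of
`|A|` more Kraus operators. -/
theorem Sandwich.exists_isTP [DecidableEq A] [DecidableEq B] [Nonempty B]
    {N M : Matrix A A ℂ →ₗ[ℂ] Matrix B B ℂ} (hTP : IsTP N) {ε : ℝ} (hε : 0 < ε)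
    (h : Sandwich N M ε) {n : ℕ} (hM : HasKraus M n) :
    ∃ M' : Matrix A A ℂ →ₗ[ℂ] Matrix B B ℂ, HasKraus M' (n + Fintype.card A) ∧ IsTP M' ∧
      ∀ ρ, IsState ρ → traceNorm (M' ρ - N ρ) ≤ 8 * ε := by
  obtain ⟨S, hSH, hS⟩ := hM.exists_trace_eq
  -- The sandwich forces tr M(ρ) ≤ 1 + 2ε, so cM never increases the trace of a state and G, which
  -- measures the deficit, is positive.
  set c : ℝ := (1 + 2 * ε)⁻¹ with hc
  have hc0 : 0 < c := by positivity
  have hc1 : c * (1 + 2 * ε) = 1 := inv_mul_cancel₀ (by positivity)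
  have hcle : c ≤ 1 := by nlinarith
  set G : Matrix A A ℂ := 1 - (c : ℂ) • S with hGdef
  have hGtr : ∀ X, (G * X).trace = X.trace - c * (M X).trace := by
    intro X
    rw [hGdef, Matrix.sub_mul, Matrix.one_mul, Matrix.smul_mul, Matrix.trace_sub,
      Matrix.trace_smul, hS, smul_eq_mul]
  have hMtr : ∀ ρ, IsState ρ → ∃ m : ℝ, (M ρ).trace = m ∧ 1 - 2 * ε ≤ m ∧ m ≤ 1 + 2 * ε := by
    intro ρ hρ
    have h1 := (Matrix.le_iff.1 (h ρ hρ).1).trace_nonneg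
    have h2 := (Matrix.le_iff.1 (h ρ hρ).2).trace_nonneg
    have h3 := (hM.posSemidef_apply hρ.1).trace_nonneg
    rw [Matrix.trace_sub, Matrix.trace_neg, Matrix.trace_sub, trace_sandwich_bound hTP hρ.2, hTP,
      hρ.2] at h1
    rw [Matrix.trace_sub, Matrix.trace_sub, trace_sandwich_bound hTP hρ.2, hTP, hρ.2] at h2
    refine ⟨(M ρ).trace.re, Complex.ext rfl (Complex.le_def.1 h3).2.symm, ?_, ?_⟩
    · have := (Complex.le_def.1 h1).1
      simp at this; linarith
    · have := (Complex.le_def.1 h2).1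
      simp at this; linarith
  have hG : G.PosSemidef := by
    refine posSemidef_of_forall_isState (Matrix.isHermitian_one.sub (hSH.smul ?_)) fun ρ hρ => ?_
    · exact Complex.conj_ofReal c
    · obtain ⟨m, hm, -, hm2⟩ := hMtr ρ hρ
      rw [hGtr, hρ.2, hm]
      norm_cast
      nlinarith
  obtain ⟨b⟩ := ‹Nonempty B›
  have hE : (Matrix.single b b (1 : ℂ)).PosSemidef := by
    rw [← Matrix.diagonal_single]
    exact Matrix.PosSemidef.diagonal fun i => by
      by_cases hi : i = b <;> simp [hi]
  have hP : HasKraus (measurePrepare G b) (Fintype.card A) := hasKraus_measurePrepare hG b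
  refine ⟨(c : ℂ) • M + measurePrepare G b, (hM.smul hc0.le).add hP, fun X => ?_, fun ρ hρ => ?_⟩
  · rw [LinearMap.add_apply, Matrix.trace_add, measurePrepare_apply, Matrix.trace_smul,
      LinearMap.smul_apply, Matrix.trace_smul, hGtr, Matrix.trace_single_eq_same]
    simp
  · obtain ⟨m, hm, hm1, hm2⟩ := hMtr ρ hρ
    set P₀ := ε • (N ρ + (Fintype.card B : ℝ)⁻¹ • (1 : Matrix B B ℂ)) with hP₀
    set Q := measurePrepare G b ρ with hQdef
    have hQ : 0 ≤ Q := (hP.posSemidef_apply hρ.1).nonneg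
    have hR : 0 ≤ (1 - c) • M ρ :=
      ((hM.posSemidef_apply hρ.1).smul (sub_nonneg.2 hcle)).nonneg
    have hdecomp : ((c : ℂ) • M + measurePrepare G b) ρ - N ρ =
        (M ρ - N ρ) - (1 - c) • M ρ + Q := by
      rw [LinearMap.add_apply, LinearMap.smul_apply, sub_smul, one_smul, Complex.coe_smul]
      abel
    have h1 := (h ρ hρ).1
    have h2 := (h ρ hρ).2
    rw [← hP₀] at h1 h2
    have htr : (P₀ + (1 - c) • M ρ + Q).trace.re = 2 * ε + (1 - c) * m + (1 - c * m) := by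
      rw [Matrix.trace_add, Matrix.trace_add, hP₀, trace_sandwich_bound hTP hρ.2,
        Matrix.trace_smul, hm, hQdef, measurePrepare_apply, Matrix.trace_smul,
        Matrix.trace_single_eq_same, hGtr, hρ.2, hm]
      simp
    rw [hdecomp]
    -- The three traces are 2ε, (1 - c)m ≤ 2ε and 1 - cm ≤ 4ε, which add up to at most 8ε.
    refine (traceNorm_le_trace (P := P₀ + (1 - c) • M ρ + Q) ?_ ?_).trans ?_
    · calc -(P₀ + (1 - c) • M ρ + Q) = -P₀ - (1 - c) • M ρ - Q := by abel
        _ ≤ (M ρ - N ρ) - (1 - c) • M ρ - 0 := sub_le_sub (sub_le_sub h1 le_rfl) hQ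
        _ = (M ρ - N ρ) - (1 - c) • M ρ + 0 := by abel
        _ ≤ _ := add_le_add le_rfl hQ
    · refine add_le_add ?_ le_rfl
      calc (M ρ - N ρ) - (1 - c) • M ρ ≤ P₀ - 0 := sub_le_sub h2 hR
        _ = P₀ + 0 := by abel
        _ ≤ _ := add_le_add le_rfl hR
    · rw [htr]
      nlinarith

/-- A compressed map with an explicit number of Kraus operators. -/
theorem exists_sandwich [DecidableEq A] [DecidableEq B] [Nonempty A] [Nonempty B]
    {N : Matrix A A ℂ →ₗ[ℂ] Matrix B B ℂ} {s : ℕ} {V : Matrix (B × Fin s) A ℂ}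
    (hV : IsStinespring V N) (hA : Fintype.card A ≤ s) (hB : Fintype.card B ≤ s) {ε : ℝ}
    (hε : 0 < ε) (hε1 : ε < 1) (hεs : 2 * ε ≤ s) :
    ∃ (M : Matrix A A ℂ →ₗ[ℂ] Matrix B B ℂ) (n : ℕ), HasKraus M n ∧ Sandwich N M ε ∧
      (n : ℝ) ≤
        400 * max (Fintype.card A : ℝ) (Fintype.card B : ℝ) * Real.log (s / ε) / ε ^ 2 := by
  set D : ℝ := max (Fintype.card A : ℝ) (Fintype.card B : ℝ) with hD
  have hD1 : 1 ≤ D := le_max_of_le_left (by exact_mod_cast Fintype.card_pos)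
  have hlog : Real.log 2 ≤ Real.log (s / ε) :=
    Real.log_le_log two_pos (by rw [le_div_iff₀ hε]; exact hεs)
  have hlog2 := Real.log_two_gt_d9
  set R : ℝ := 200 * D * Real.log (s / ε) / ε ^ 2 with hR
  -- Since 2ε ≤ s, the logarithm is at least log 2. With R ≥ 1, rounding up costs at most a factor
  -- 2, whence 400.
  have hR1 : 1 ≤ R := by
    rw [hR, le_div_iff₀ (by positivity)]
    nlinarith
  have hprob := half_le_iidUniform_sandwich hV hA hB hε hε1 (n := ⌈R⌉₊) (Nat.le_ceil R)
  obtain ⟨φ, hφ⟩ : {φ : Fin ⌈R⌉₊ → UnitSphere s | Sandwich N (sampledMap V φ) ε}.Nonempty := by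
    rw [Set.nonempty_iff_ne_empty]
    intro h0
    simp [h0] at hprob
  refine ⟨sampledMap V φ, ⌈R⌉₊, hasKraus_sampledMap V φ, hφ, ?_⟩
  have h1 := (Nat.ceil_lt_add_one (by linarith : 0 ≤ R)).le
  have h2 : 400 * D * Real.log (s / ε) / ε ^ 2 = 2 * R := by rw [hR]; ring
  rw [h2]
  linarith

/-- For large `ε` and one-dimensional output the zero map is an approximation. -/
theorem sandwich_zero [DecidableEq A] [DecidableEq B]
    {N : Matrix A A ℂ →ₗ[ℂ] Matrix B B ℂ} {s : ℕ} {V : Matrix (B × Fin s) A ℂ}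
    (hV : IsStinespring V N) (hB : Fintype.card B = 1) {ε : ℝ} (hε : 1 ≤ 2 * ε) :
    Sandwich N 0 ε := by
  refine sandwich_of_forall (basisKraus V) (Fin.elim0 : Fin 0 → Matrix B A ℂ)
    (fun X => by rw [hV.2, partialTrace_eq_sum_basisKraus]) (fun X => by simp) fun x y => ?_
  have h3 : ‖envVec V (WithLp.toLp 2 x) (WithLp.toLp 2 y)‖ ^ 2 =
    ∑ e, ‖star y ⬝ᵥ (basisKraus V e *ᵥ x)‖ ^ 2 := EuclideanSpace.norm_sq_eq _
  have h := pow_le_pow_left₀ (norm_nonneg _)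
    (norm_envVec_le hV.1 (WithLp.toLp 2 x) (WithLp.toLp 2 y)) 2
  rw [mul_pow, h3, EuclideanSpace.norm_sq_eq, EuclideanSpace.norm_sq_eq] at h
  have h0 : 0 ≤ ∑ e, ‖star y ⬝ᵥ (basisKraus V e *ᵥ x)‖ ^ 2 := by positivity
  simp only [Finset.univ_eq_empty, Finset.sum_empty, zero_sub, abs_neg, abs_of_nonneg h0, hB,
    Nat.cast_one, inv_one, one_mul]
  nlinarith

end Consequences

end ChannelCompression

/-! ### Assembly of the three claims -/

theorem theorem1 :
    ∃ C : ℝ, 0 < C ∧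
      ∀ (A B : Type*) [Fintype A] [DecidableEq A] [Nonempty A]
        [Fintype B] [DecidableEq B] [Nonempty B]
        (N : Matrix A A ℂ →ₗ[ℂ] Matrix B B ℂ) (s : ℕ) (ε : ℝ),
        ChannelCompression.IsCP N → ChannelCompression.IsTP N →
        ChannelCompression.krausRank N = s →
        Fintype.card A ≤ s → Fintype.card B ≤ s →
        0 < ε → ε < 1 →
        -- existence of the compressed completely positive map
        (∃ M : Matrix A A ℂ →ₗ[ℂ] Matrix B B ℂ,
          ChannelCompression.IsCP M ∧
          (ChannelCompression.krausRank M : ℝ) ≤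
            C * max (Fintype.card A : ℝ) (Fintype.card B : ℝ) * Real.log (s / ε) / ε ^ 2 ∧
          ChannelCompression.Sandwich N M ε ∧
          ∀ ρ : Matrix A A ℂ, ChannelCompression.IsState ρ →
            ChannelCompression.traceNorm (M ρ - N ρ) ≤ 2 * ε) ∧
        -- random sampling of environment vectors produces such a map
        (∀ V : Matrix (B × Fin s) A ℂ, ChannelCompression.IsStinespring V N →
          ∀ n : ℕ,
            C * max (Fintype.card A : ℝ) (Fintype.card B : ℝ) * Real.log (s / ε) / ε ^ 2 ≤ n →
            1 / 2 ≤ ChannelCompression.iidUniform s n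
              {φ | ChannelCompression.IsCP (ChannelCompression.sampledMap V φ) ∧
                ChannelCompression.krausRank (ChannelCompression.sampledMap V φ) ≤ n ∧
                ChannelCompression.Sandwich N (ChannelCompression.sampledMap V φ) ε}) ∧
        -- trace preserving version
        (2 * ε ≤ s →
          ∃ M : Matrix A A ℂ →ₗ[ℂ] Matrix B B ℂ,
            ChannelCompression.IsCP M ∧ ChannelCompression.IsTP M ∧
            (ChannelCompression.krausRank M : ℝ) ≤
              C * max (Fintype.card A : ℝ) (Fintype.card B : ℝ) * Real.log (s / ε) / ε ^ 2 ∧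
            ∀ ρ : Matrix A A ℂ, ChannelCompression.IsState ρ →
              ChannelCompression.traceNorm (M ρ - N ρ) ≤ 2 * ε) := by
  open ChannelCompression in
  -- The trace-preserving claim is the most demanding: 20000 = 19200 + 800.
  refine ⟨20000, by norm_num, ?_⟩
  intro A B _ _ _ _ _ _ N s ε _ hTP hrank hA hB hε hε1
  have hA0 : 0 < Fintype.card A := Fintype.card_pos
  have hB0 : 0 < Fintype.card B := Fintype.card_pos
  have hs : 0 < s := hA0.trans_le hA
  have hs1 : (1 : ℝ) ≤ s := by exact_mod_cast hs
  have hN : HasKraus N s := hrank ▸ hasKraus_krausRank (hrank ▸ hs)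
  obtain ⟨V, hV⟩ := hN.exists_isStinespring hTP
  have hlog : 0 < Real.log (s / ε) := Real.log_pos (by rw [lt_div_iff₀ hε]; linarith)
  have hmono : ∀ C : ℝ, C ≤ 20000 →
      C * max (Fintype.card A : ℝ) (Fintype.card B : ℝ) * Real.log (s / ε) / ε ^ 2 ≤
        20000 * max (Fintype.card A : ℝ) (Fintype.card B : ℝ) * Real.log (s / ε) / ε ^ 2 := by
    intro C hC
    gcongr
  refine ⟨?_, ?_, ?_⟩
  · by_cases hεs : 2 * ε ≤ s
    · obtain ⟨M, n, hM, hS, hn⟩ := exists_sandwich hV hA hB hε hε1 hεs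
      refine ⟨M, hM.isCP, ?_, hS, fun ρ hρ => hS.traceNorm_le hTP hρ⟩
      exact (Nat.cast_le.2 hM.krausRank_le).trans (hn.trans (hmono _ (by norm_num)))
    -- Here s = |A| = |B| = 1 and ε > 1/2. As ε tends to 1 the rank bound drops below 1, so a map of
    -- Kraus rank 0 is required.
    · push Not at hεs
      have hs2 : s < 2 := by
        have : (s : ℝ) < 2 := by linarith
        exact_mod_cast this
      have hS : Sandwich N 0 ε := sandwich_zero hV (by omega) (by linarith)
      refine ⟨0, hasKraus_zero.isCP, ?_, hS, fun ρ hρ => hS.traceNorm_le hTP hρ⟩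
      rw [Nat.le_zero.1 (hasKraus_zero (A := A) (B := B)).krausRank_le, Nat.cast_zero]
      positivity
  · intro W hW n hn
    refine (half_le_iidUniform_sandwich hW hA hB hε hε1
      ((hmono _ (by norm_num)).trans hn)).trans (MeasureTheory.measure_mono fun φ hφ => ?_)
    exact ⟨(hasKraus_sampledMap W φ).isCP, (hasKraus_sampledMap W φ).krausRank_le, hφ⟩
  · intro hεs
    -- The correction multiplies the accuracy by 8, so ε/4 yields 2ε. The price is 400 · 3 · 16 =
    -- 19200, with 3 from log(4s/ε) ≤ 3 log(s/ε).
    obtain ⟨M, n, hM, hS, hn⟩ := exists_sandwich hV hA hB (ε := ε / 4) (by positivity)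
      (by linarith) (by linarith)
    obtain ⟨M', hM', hTP', htr⟩ := hS.exists_isTP hTP (by positivity) hM
    refine ⟨M', hM'.isCP, hTP', ?_, fun ρ hρ => (htr ρ hρ).trans (by linarith)⟩
    refine (Nat.cast_le.2 hM'.krausRank_le).trans ?_
    push_cast
    set D : ℝ := max (Fintype.card A : ℝ) (Fintype.card B : ℝ) with hD
    have hAD : (Fintype.card A : ℝ) ≤ D := le_max_left _ _
    have hD0 : 0 ≤ D := le_trans (Nat.cast_nonneg _) hAD
    have hlog2 := Real.log_two_gt_d9
    have hL : Real.log 2 ≤ Real.log (s / ε) :=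
      Real.log_le_log two_pos (by rw [le_div_iff₀ hε]; exact hεs)
    have hL4 : Real.log (s / (ε / 4)) ≤ 3 * Real.log (s / ε) := by
      rw [show (s : ℝ) / (ε / 4) = 2 ^ 2 * (s / ε) by field_simp; norm_num,
        Real.log_mul (by norm_num) (by positivity), Real.log_pow]
      push_cast
      linarith
    have h1 : (n : ℝ) ≤ 19200 * D * Real.log (s / ε) / ε ^ 2 := by
      calc (n : ℝ) ≤ 400 * D * (3 * Real.log (s / ε)) / (ε / 4) ^ 2 := hn.trans (by gcongr)
        _ = _ := by ring
    -- The |A| extra Kraus operators are absorbed because log(s/ε) ≥ log 2 and ε < 1.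
    have h2 : (Fintype.card A : ℝ) ≤ 800 * D * Real.log (s / ε) / ε ^ 2 := by
      refine hAD.trans ?_
      rw [le_div_iff₀ (by positivity)]
      calc D * ε ^ 2 ≤ D * 1 := by gcongr; exact pow_le_one₀ hε.le hε1.le
        _ ≤ D * (800 * Real.log (s / ε)) := by gcongr; linarith
        _ = _ := by ring
    calc (n : ℝ) + Fintype.card A ≤ 19200 * D * Real.log (s / ε) / ε ^ 2 +
          800 * D * Real.log (s / ε) / ε ^ 2 := add_le_add h1 h2
      _ = _ := by ring
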